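/- Let $(V,g)$ be a finite-dimensional real vector space with a positive definite metric, and let $\mathcal T=\{K\in \mathrm{End}\,V : K^2=-\mathbb 1,\ g(K\cdot,K\cdot)=g(\cdot,\cdot)\}$, a submanifold of $\mathrm{End}\,V$ with $T_K\mathcal T=\mathfrak o_{\{K\}}:=\{A\in\mathfrak o(V,g) : AK+KA=0\}$. Let $\phi$ be the section of $\mathrm{End}\,V\times\mathcal T$ with $\phi|_K=K$, write $\{A,B\}=AB+BA$ and $[A,B]=AB-BA$, fix $J\in\mathcal T$, and let $\mathfrak u(J)=\{B\in\mathfrak o(V,g):[B,J]=0\}$. For a section $F:\mathcal T\to \mathrm{End}\,V$ define, at each $K\in\mathcal T$, \[\mathcal D^F|_K=\{B\in\mathfrak o_{\{K\}} : B(\mathrm{Ker}\,F_K)=0,\ B(\mathrm{Im}\,F_K)\subset \mathrm{Im}\,F_K\},\] \[\mathcal D^F_{\mathfrak u(J)}|_K=\{[B,K] : B\in\mathfrak u(J),\ B(\mathrm{Ker}\,F_K)=0,\ B(\mathrm{Im}\,F_K)\subset \mathrm{Im}\,F_K\}.\] These distributions may have varying rank; such a distribution $\mathcal D$ is called integrable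 if it is smooth (each of its vectors extends to a smooth vector field with values in $\mathcal D$) and through every point of $\mathcal T$ there passes an integral manifold, that is, an immersed submanifold whose tangent space at each of its points is the fibre of $\mathcal D$ there. Its leaves are the maximal connected integral manifolds. Let $S\in\{\mathbb 1,\ J+\phi,\ J-\phi,\ [J,\phi]\}$. (A) Let $Q:\mathcal T\to\mathrm{End}\,V$ be smooth with $Q^*=Q$, $[Q,J]=0$ and $[Q,\phi]=0$. 1) $\mathcal D^{QS}$ is integrable if $dQ_{QBQ}=Q(dQ_B)Q$ for all $B\in\mathcal D^S$. 2) $\mathcal D^{QS}_{\mathfrak u(J)}$ is integrable if $dQ_{QCQ}=Q(dQ_C)Q$ for all $C\in\mathcal D^S_{\mathfrak u(J)}$. (B) Let $Q=a_k\{J,\phi\}^k+\dots+a_1\{J,\phi\}+a_0\mathbb 1$ with $a_i\in C^\infty(\mathcal T)$. 1) $\mathcal D^{QS}$ is integrable if $d{a_i}_B=0$ for all $i$ and all $B\in\mathcal D^S$. 2) $\mathcal D^{QS}_{\mathfrak u(J)}$ is integrable if $d{a_i}_C=0$ for all $i$ and all $C\in\mathcal D^S_{\mathfrak u(J)}$.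 (C) $\mathcal D^S$ and $\mathcal D^S_{\mathfrak u(J)}$ are integrable, and, for $Q$ as in (B), $\mathcal D^{QS}$ (respectively $\mathcal D^{QS}_{\mathfrak u(J)}$) is integrable if each $a_i$ is constant along the leaves of $\mathcal D^S$ (respectively of $\mathcal D^S_{\mathfrak u(J)}$). -/

import Mathlib

open scoped ContDiff

/-! ### Singular distributions on a submanifold of a normed space -/

section Distributions

variable {E : Type*} [NormedAddCommGroup E] [NormedSpace ℝ E]

/-- `f : U → M`, with `U ⊆ ℝᵈ` open and connected, is an injective immersion whose image is an
integral manifold of `D`: the tangent space of the image at each of its points `x` is `D x`. -/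
structure IsIntegralPatch (M : Set E) (D : E → Submodule ℝ E) {d : ℕ}
    (U : Set (EuclideanSpace ℝ (Fin d))) (f : EuclideanSpace ℝ (Fin d) → E) : Prop where
  isOpen : IsOpen U
  isConnected : IsConnected U
  contDiffOn : ContDiffOn ℝ ∞ f U
  mapsTo : Set.MapsTo f U M
  injOn : Set.InjOn f U
  immersion : ∀ u ∈ U, Function.Injective (fderiv ℝ f u)
  tangent : ∀ u ∈ U, (fderiv ℝ f u).range = D (f u)

/-- `D`, possibly of varying rank, is smooth: every vector of `D` is the value of a smooth
vector field with values in `D`. -/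
def IsSmoothDistribution (M : Set E) (D : E → Submodule ℝ E) : Prop :=
  ∀ x ∈ M, ∀ v ∈ D x, ∃ X : E → E,
    ContDiffOn ℝ ∞ X M ∧ (∀ y ∈ M, X y ∈ D y) ∧ X x = v

/-- Integrability of a distribution of possibly varying rank (in the sense of Stefan and Sussmann):
it is smooth and through every point of `M` there passes an integral manifold. -/
def IsIntegrableDistribution (M : Set E) (D : E → Submodule ℝ E) : Prop :=
  IsSmoothDistribution M D ∧
    ∀ x ∈ M, ∃ (d : ℕ) (U : Set (EuclideanSpace ℝ (Fin d))) (f : EuclideanSpace ℝ (Fin d) → E),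
      IsIntegralPatch M D U f ∧ x ∈ f '' U

/-- The leaf of `D` through `x`: the points that can be joined to `x` by a finite chain of
connected integral manifolds of `D`. -/
def leafThrough (M : Set E) (D : E → Submodule ℝ E) (x : E) : Set E :=
  {y | Relation.EqvGen (fun p q : E =>
    ∃ (d : ℕ) (U : Set (EuclideanSpace ℝ (Fin d))) (f : EuclideanSpace ℝ (Fin d) → E),
      IsIntegralPatch M D U f ∧ p ∈ f '' U ∧ q ∈ f '' U) x y}

def ConstantAlongLeaves (M : Set E) (D : E → Submodule ℝ E) (a : E → ℝ) : Prop :=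
  ∀ x ∈ M, ∀ y ∈ leafThrough M D x, a y = a x

end Distributions

/-! ### The twistor space and its distributions -/

section Twistor

variable {V : Type*} [NormedAddCommGroup V] [InnerProductSpace ℝ V]

variable (V) in
/-- The orthogonal complex structures on `V`, as a submanifold of `End V`. -/
def twistorSpace : Set (V →L[ℝ] V) :=
  {K | K * K = -1 ∧ ∀ v w : V, inner ℝ (K v) (K w) = inner ℝ v w}

variable (V) in
/-- The Lie algebra `𝔬(V, g)` of skew-adjoint endomorphisms. -/
def skewEnd : Submodule ℝ (V →L[ℝ] V) where
  carrier := {A | ∀ v w : V, inner ℝ (A v) w = -inner ℝ v (A w)}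
  zero_mem' := by intro v w; simp
  add_mem' := by
    intro A B hA hB v w
    have h1 := hA v w
    have h2 := hB v w
    simp only [ContinuousLinearMap.add_apply, inner_add_left, inner_add_right, h1, h2]
    ring
  smul_mem' := by
    intro c A hA v w
    have h1 := hA v w
    simp only [ContinuousLinearMap.smul_apply, real_inner_smul_left, real_inner_smul_right, h1]
    ring

/-- `{A, B} = AB + BA`. -/
def antiComm (A B : V →L[ℝ] V) : V →L[ℝ] V := A * B + B * A

/-- The skew endomorphisms that anticommute with `K`; for `K` in the twistor space this is the
tangent space of the twistor space at `K`. -/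
def skewAnti (K : V →L[ℝ] V) : Submodule ℝ (V →L[ℝ] V) where
  carrier := {A | A ∈ skewEnd V ∧ antiComm A K = 0}
  zero_mem' := ⟨zero_mem _, by simp [antiComm]⟩
  add_mem' := by
    rintro A B ⟨hA, hA'⟩ ⟨hB, hB'⟩
    refine ⟨add_mem hA hB, ?_⟩
    have h : antiComm (A + B) K = antiComm A K + antiComm B K := by
      simp only [antiComm, add_mul, mul_add]; abel
    rw [h, hA', hB', add_zero]
  smul_mem' := by
    rintro c A ⟨hA, hA'⟩
    refine ⟨Submodule.smul_mem _ c hA, ?_⟩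
    have h : antiComm (c • A) K = c • antiComm A K := by
      simp only [antiComm, smul_mul_assoc, mul_smul_comm, smul_add]
    rw [h, hA', smul_zero]

/-- The map `B ↦ [B, K] = BK - KB`. -/
def commWith (K : V →L[ℝ] V) : (V →L[ℝ] V) →ₗ[ℝ] (V →L[ℝ] V) where
  toFun B := B * K - K * B
  map_add' A B := by simp only [add_mul, mul_add]; abel
  map_smul' c A := by
    simp only [smul_mul_assoc, mul_smul_comm, smul_sub, RingHom.id_apply]

/-- `𝔲(V, J)`: the skew endomorphisms that commute with `J`. -/
def unitaryAlg (J : V →L[ℝ] V) : Submodule ℝ (V →L[ℝ] V) :=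
  skewEnd V ⊓ LinearMap.ker (commWith J)

/-- The endomorphisms `B` with `B : Ker F → 0` and `B : Im F → Im F`. -/
def kerZeroImStable (F : V →L[ℝ] V) : Submodule ℝ (V →L[ℝ] V) where
  carrier := {B | (∀ v : V, F v = 0 → B v = 0) ∧ ∀ v : V, ∃ w : V, B (F v) = F w}
  zero_mem' := ⟨fun _ _ => rfl, fun _ => ⟨0, by simp⟩⟩
  add_mem' := by
    rintro A B ⟨hA, hA'⟩ ⟨hB, hB'⟩
    refine ⟨fun v hv => by simp [hA v hv, hB v hv], fun v => ?_⟩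
    obtain ⟨w, hw⟩ := hA' v
    obtain ⟨w', hw'⟩ := hB' v
    exact ⟨w + w', by simp [hw, hw']⟩
  smul_mem' := by
    rintro c A ⟨hA, hA'⟩
    refine ⟨fun v hv => by simp [hA v hv], fun v => ?_⟩
    obtain ⟨w, hw⟩ := hA' v
    exact ⟨c • w, by simp [hw]⟩

/-- The distribution `𝒟^F`, for a section `F` of `End V` over the twistor space. -/
def distF (F : (V →L[ℝ] V) → (V →L[ℝ] V)) (K : V →L[ℝ] V) : Submodule ℝ (V →L[ℝ] V) :=
  skewAnti K ⊓ kerZeroImStable (F K)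

/-- The distribution `𝒟^F_{𝔲(J)}`: at `K` it consists of the `[B, K]` with `B ∈ 𝔲(V, J)`,
`B : Ker F → 0` and `B : Im F → Im F`. (Such brackets always lie in `skewAnti K`.) -/
def distU (J : V →L[ℝ] V) (F : (V →L[ℝ] V) → (V →L[ℝ] V)) (K : V →L[ℝ] V) :
    Submodule ℝ (V →L[ℝ] V) :=
  (unitaryAlg J ⊓ kerZeroImStable (F K)).map (commWith K)

/-- The four sections `1`, `J + φ`, `J - φ`, `[J, φ]`, where `φ` is the section `φ|_K = K`. -/
def basicSections (J : V →L[ℝ] V) : Set ((V →L[ℝ] V) → (V →L[ℝ] V)) :=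
  {fun _ => 1, fun K => J + K, fun K => J - K, fun K => J * K - K * J}

/-- Smoothness of a map on the twistor space; only its values there matter. -/
def SmoothOnTwistor {W : Type*} [NormedAddCommGroup W] [NormedSpace ℝ W]
    (f : (V →L[ℝ] V) → W) : Prop :=
  ContDiffOn ℝ ∞ f (twistorSpace V)

/-- The derivative `df_B` at `K` of a map on the twistor space. For smooth `f` and `B` tangent to
the twistor space at `K` it is the usual one, determined by the values of `f` on the twistor
space (`B` is then the velocity of a curve in the twistor space). -/
noncomputable def dTwistor {W : Type*} [NormedAddCommGroup W] [NormedSpace ℝ W]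
    (f : (V →L[ℝ] V) → W) (K B : V →L[ℝ] V) : W :=
  fderivWithin ℝ f (twistorSpace V) K B

/-- `Q` is a smooth section with `Q* = Q`, `[Q, J] = 0` and `[Q, φ] = 0`. -/
structure IsAdmissible (J : V →L[ℝ] V) (Q : (V →L[ℝ] V) → (V →L[ℝ] V)) : Prop where
  smooth : SmoothOnTwistor Q
  selfAdjoint : ∀ K ∈ twistorSpace V, ∀ v w : V, inner ℝ (Q K v) w = inner ℝ v (Q K w)
  comm_J : ∀ K ∈ twistorSpace V, Q K * J = J * Q K
  comm_phi : ∀ K ∈ twistorSpace V, Q K * K = K * Q K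

/-- `dQ_{QBQ} = Q (dQ_B) Q` for all `B ∈ D`. -/
def QCondition (Q : (V →L[ℝ] V) → (V →L[ℝ] V))
    (D : (V →L[ℝ] V) → Submodule ℝ (V →L[ℝ] V)) : Prop :=
  ∀ K ∈ twistorSpace V, ∀ B ∈ D K,
    dTwistor Q K (Q K * B * Q K) = Q K * dTwistor Q K B * Q K

/-- `da_B = 0` for all `B ∈ D`. -/
def AnnihilatedAlong (a : (V →L[ℝ] V) → ℝ)
    (D : (V →L[ℝ] V) → Submodule ℝ (V →L[ℝ] V)) : Prop :=
  ∀ K ∈ twistorSpace V, ∀ B ∈ D K, dTwistor a K B = 0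

/-- `Q = a_k {J, φ}^k + ... + a_1 {J, φ} + a_0 1`. -/
noncomputable def polyQ (J : V →L[ℝ] V) {k : ℕ} (a : Fin (k + 1) → (V →L[ℝ] V) → ℝ)
    (K : V →L[ℝ] V) : V →L[ℝ] V :=
  ∑ i : Fin (k + 1), a i K • antiComm J K ^ (i : ℕ)

end Twistor

/-!
Both distributions are ranges of smooth bundle maps: `𝒟^F` at `K` is the range of `C ↦ P (F C F)`,
where `P` projects onto the skew endomorphisms anticommuting with `K`, and `𝒟^F_{𝔲(J)}` is
obtained in the same way from the skew endomorphisms commuting with `J`, followed by `[·, K]`.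
This uses that `F` is self-adjoint or skew-adjoint and intertwines `φ` and `J` with sections over
the twistor space.

Such a family of vector fields is involutive as soon as the derivative of `F` along `F C F` is of
the form `F θ`. For `F = QS` this comes from the explicit derivative of `S`, from differentiating
the commutation of `Q` with `S`, and from the condition on `dQ`. For polynomial `Q` the condition
holds because `{J, φ}` satisfies it: `S` commutes with `{J, φ}`.

An involutive family `R · c` whose rank varies is integrated directly. Near `x₀` choose a partial
frame `X`, spanning the range of `R` at `x₀` and normalized by a fixed projection `p`. The part of
`R` not spanned by `X` solves a linear differential inequality along the flow lines of `X · u`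
starting at `x₀`, so it vanishes there; where it vanishes the fields of the frame commute. Hence
`u ↦ exp (X · u) x₀` solves `df = X ∘ f` and parametrizes the integral manifold through `x₀`.
-/

/-! ### The total differential equation `df = X ∘ f` -/

section TotalDifferential

open Set Metric Filter Topology
open scoped NNReal

variable {E W F : Type*} [NormedAddCommGroup E] [NormedSpace ℝ E] [NormedAddCommGroup W]
  [NormedSpace ℝ W] [NormedAddCommGroup F] [NormedSpace ℝ F]

theorem exists_isIntegralCurveOn_mem_closedBall [CompleteSpace E] {v : E → E} {x₀ : E}
    {a K L : ℝ≥0} (hb : ∀ x ∈ closedBall x₀ a, ‖v x‖ ≤ L)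
    (hl : LipschitzOnWith K v (closedBall x₀ a)) (hLa : L ≤ a) :
    ∃ α : ℝ → E, α 0 = x₀ ∧ (∀ t ∈ Icc (0 : ℝ) 1, α t ∈ closedBall x₀ a) ∧
      IsIntegralCurveOn α (fun _ => v) (Icc 0 1) := by
  have hf : IsPicardLindelof (fun _ => v) (tmin := 0) (tmax := 1) ⟨0, by simp⟩ x₀ a 0 L K :=
    .of_time_independent hb hl (by simpa using hLa)
  obtain ⟨α, hα⟩ := ODE.FunSpace.exists_isFixedPt_next hf (mem_closedBall_self le_rfl)
  have hmem : ∀ {t : ℝ}, α.compProj t ∈ closedBall x₀ a :=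
    α.compProj_mem_closedBall hf.mul_max_le
  have hpicard : ∀ t ∈ Icc (0 : ℝ) 1,
      α.compProj t = ODE.picard (fun _ => v) 0 x₀ α.compProj t := fun t ht => by
    nth_rw 1 [← hα]
    rw [ODE.FunSpace.compProj_of_mem ht, ODE.FunSpace.next_apply]
  refine ⟨α.compProj, by rw [hpicard 0 (by simp), ODE.picard_apply₀], fun _ _ => hmem,
    fun t ht => ?_⟩
  exact (ODE.hasDerivWithinAt_picard_Icc (f := fun _ => v) (t₀ := 0) (by simp)
    hf.continuousOn_uncurry α.continuous_compProj.continuousOn (fun _ _ => hmem) x₀ ht)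
    |>.congr_of_mem hpicard ht

theorem gronwallBound_zero_eq_mul (K ε x : ℝ) :
    gronwallBound 0 K ε x = ε * gronwallBound 0 K 1 x := by
  unfold gronwallBound
  split_ifs <;> ring

theorem norm_sub_sub_fderiv_le {X : E → F} {s : Set E} (hs : Convex ℝ s)
    (hd : ∀ y ∈ s, DifferentiableAt ℝ X y) {m : ℝ≥0} (hl : LipschitzOnWith m (fderiv ℝ X) s)
    {y z : E} (hy : y ∈ s) (hz : z ∈ s) :
    ‖X z - X y - fderiv ℝ X y (z - y)‖ ≤ m * ‖z - y‖ ^ 2 := by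
  have hseg : segment ℝ y z ⊆ s := hs.segment_subset hy hz
  have hbound : ∀ w ∈ segment ℝ y z, ‖fderiv ℝ X w - fderiv ℝ X y‖ ≤ m * ‖z - y‖ := fun w hw =>
    (hl.norm_sub_le (hseg hw) hy).trans <| by
      gcongr
      simpa [dist_eq_norm, norm_sub_rev y] using segment_subset_closedBall_left y z hw
  calc ‖X z - X y - fderiv ℝ X y (z - y)‖ ≤ m * ‖z - y‖ * ‖z - y‖ :=
        (convex_segment y z).norm_image_sub_le_of_norm_hasFDerivWithin_le'
          (fun w hw => (hd w (hseg hw)).hasFDerivAt.hasFDerivWithinAt) hbound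
          (left_mem_segment ℝ y z) (right_mem_segment ℝ y z)
    _ = m * ‖z - y‖ ^ 2 := by ring

/-- `X` and its derivative are bounded by `m` on `s`, and the derivative is `m`-Lipschitz there. -/
structure IsC11BoundedOn (X : E → F) (s : Set E) (m : ℝ≥0) : Prop where
  differentiableAt : ∀ y ∈ s, DifferentiableAt ℝ X y
  norm_le : ∀ y ∈ s, ‖X y‖ ≤ m
  norm_fderiv_le : ∀ y ∈ s, ‖fderiv ℝ X y‖ ≤ m
  lipschitzOnWith_fderiv : LipschitzOnWith m (fderiv ℝ X) s

theorem IsC11BoundedOn.mono {X : E → F} {s t : Set E} {m : ℝ≥0} (hX : IsC11BoundedOn X t m)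
    (hst : s ⊆ t) : IsC11BoundedOn X s m :=
  ⟨fun y hy => hX.1 y (hst hy), fun y hy => hX.2 y (hst hy), fun y hy => hX.3 y (hst hy),
    hX.4.mono hst⟩

theorem exists_isC11BoundedOn_closedBall {X : E → F} {x₀ : E} (hX : ContDiffAt ℝ 2 X x₀)
    {Ω : Set E} (hΩ : Ω ∈ 𝓝 x₀) :
    ∃ (b m : ℝ≥0), 0 < b ∧ closedBall x₀ b ⊆ Ω ∧ IsC11BoundedOn X (closedBall x₀ b) m := by
  have hDX : ContDiffAt ℝ 1 (fderiv ℝ X) x₀ := hX.fderiv_right (by norm_num)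
  obtain ⟨K, s, hs, hl⟩ := hDX.exists_lipschitzOnWith
  obtain ⟨ε, hε, hsub⟩ := nhds_basis_closedBall.eventually_iff.1 <|
    (((hX.eventually (by simp)).and hs).and hΩ).and
      ((hX.continuousAt.norm.eventually_le_const (lt_add_one _)).and
        (hDX.continuousAt.norm.eventually_le_const (lt_add_one _)))
  lift ε to ℝ≥0 using hε.le
  refine ⟨ε, max K (max (‖X x₀‖₊ + 1) (‖fderiv ℝ X x₀‖₊ + 1)), by exact_mod_cast hε,
    fun y hy => (hsub hy).1.2, fun y hy => (hsub hy).1.1.1.differentiableAt (by simp),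
    fun y hy => (hsub hy).2.1.trans ?_, fun y hy => (hsub hy).2.2.trans ?_,
    (hl.mono fun y hy => (hsub hy).1.1.2).weaken (le_max_left _ _)⟩
  · exact_mod_cast (le_max_left (‖X x₀‖₊ + 1) _).trans (le_max_right _ _)
  · exact_mod_cast (le_max_right _ (‖fderiv ℝ X x₀‖₊ + 1)).trans (le_max_right _ _)

theorem IsC11BoundedOn.lipschitzOnWith_apply {X : E → W →L[ℝ] F} {s : Set E} {m δ : ℝ≥0}
    (hX : IsC11BoundedOn X s m) (hs : Convex ℝ s) {u : W} (hu : ‖u‖ ≤ δ) :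
    LipschitzOnWith (m * δ) (fun y => X y u) s := by
  have hlip := hs.lipschitzOnWith_of_nnnorm_fderiv_le hX.differentiableAt hX.norm_fderiv_le
  refine LipschitzOnWith.of_dist_le_mul fun y hy z hz => ?_
  calc dist (X y u) (X z u) = ‖(X y - X z) u‖ := by rw [dist_eq_norm, sub_apply]
    _ ≤ (m * dist y z) * δ :=
      (X y - X z).le_of_opNorm_le_of_le (by simpa [dist_eq_norm] using hlip.dist_le_mul y hy z hz)
        hu
    _ = (m * δ : ℝ≥0) * dist y z := by push_cast; ring

/-- `γ` is, on `[0, 1]`, the integral curve of the field `X · u` that starts at `x₀`, and it stays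
in `s`; its endpoint is the time-one flow `exp (X · u) x₀`. -/
structure IsFlowLine (X : E → W →L[ℝ] E) (s : Set E) (x₀ : E) (u : W) (γ : ℝ → E) : Prop where
  map_zero : γ 0 = x₀
  mem : ∀ t ∈ Icc (0 : ℝ) 1, γ t ∈ s
  isIntegralCurveOn : IsIntegralCurveOn γ (fun _ y => X y u) (Icc 0 1)

namespace IsFlowLine

variable {X : E → W →L[ℝ] E} {s t : Set E} {x₀ : E} {u h : W} {γ : ℝ → E}

theorem mono (hγ : IsFlowLine X s x₀ u γ) (hst : s ⊆ t) : IsFlowLine X t x₀ u γ :=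
  ⟨hγ.map_zero, fun t ht => hst (hγ.mem t ht), hγ.isIntegralCurveOn⟩

theorem hasDerivWithinAt_Ici (hγ : IsFlowLine X s x₀ u γ) {t : ℝ} (ht : t ∈ Ico (0 : ℝ) 1) :
    HasDerivWithinAt γ (X (γ t) u) (Ici t) t :=
  (hγ.isIntegralCurveOn t (Ico_subset_Icc_self ht)).mono_of_mem_nhdsWithin
    (Icc_mem_nhdsGE_of_mem ht)

theorem map_one_of_zero (hγ : IsFlowLine X s x₀ 0 γ) : γ 1 = x₀ :=
  (constant_of_has_deriv_right_zero hγ.isIntegralCurveOn.continuousOn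
    (fun t ht => by simpa using hγ.hasDerivWithinAt_Ici ht) 1 (by simp)).trans hγ.map_zero

theorem hasDerivWithinAt_comp (hγ : IsFlowLine X s x₀ u γ) {G : E → F} {t : ℝ}
    (ht : t ∈ Icc (0 : ℝ) 1) (hG : DifferentiableAt ℝ G (γ t)) :
    HasDerivWithinAt (fun t => G (γ t)) (fderiv ℝ G (γ t) (X (γ t) u)) (Icc 0 1) t :=
  hG.hasFDerivAt.comp_hasDerivWithinAt t (hγ.isIntegralCurveOn t ht)

theorem eq_zero_of_norm_fderiv_le (hγ : IsFlowLine X s x₀ u γ) {G : E → F}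
    (hG : ∀ y ∈ s, DifferentiableAt ℝ G y) (h0 : G x₀ = 0) {C : ℝ}
    (hC : ∀ t ∈ Icc (0 : ℝ) 1, ‖fderiv ℝ G (γ t) (X (γ t) u)‖ ≤ C * ‖G (γ t)‖) :
    ∀ t ∈ Icc (0 : ℝ) 1, G (γ t) = 0 := by
  have hderiv := fun t ht => hγ.hasDerivWithinAt_comp ht (hG _ (hγ.mem t ht))
  refine eq_zero_of_abs_deriv_le_mul_abs_self_of_eq_zero_right
    (fun t ht => (hderiv t ht).continuousWithinAt)
    (fun t ht => (hderiv t (Ico_subset_Icc_self ht)).mono_of_mem_nhdsWithin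
      (Icc_mem_nhdsGE_of_mem ht))
    (by simp only [hγ.map_zero, h0]) fun t ht => hC t (Ico_subset_Icc_self ht)

theorem hasDerivWithinAt_add_smul (hγ : IsFlowLine X s x₀ u γ)
    (hX : ∀ y ∈ s, DifferentiableAt ℝ X y) {t : ℝ} (ht : t ∈ Icc (0 : ℝ) 1) :
    HasDerivWithinAt (fun t => γ t + t • X (γ t) h)
      (X (γ t) u + (X (γ t) h + t • fderiv ℝ X (γ t) (X (γ t) u) h)) (Icc 0 1) t := by
  have hXh : HasDerivWithinAt (fun t => X (γ t) h) (fderiv ℝ X (γ t) (X (γ t) u) h)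
      (Icc 0 1) t := by
    simpa using (hγ.hasDerivWithinAt_comp ht (hX _ (hγ.mem t ht))).clm_apply
      (hasDerivWithinAt_const t _ h)
  convert! (hγ.isIntegralCurveOn t ht).add ((hasDerivWithinAt_id t (Icc (0 : ℝ) 1)).smul hXh)
    using 1
  simp only [id_eq, one_smul]
  abel

end IsFlowLine

/-- The variation `t ↦ γ t + t • X (γ t) h` of a flow line `γ` of `X · u` solves the equation for
`X · (u + h)` up to a quadratic error: compatibility makes the first order terms cancel. -/
theorem IsC11BoundedOn.norm_variation_sub_le {X : E → W →L[ℝ] E} {s : Set E} {m : ℝ≥0}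
    (hX : IsC11BoundedOn X s m) (hs : Convex ℝ s) {y : E} {t δ : ℝ} {u h : W}
    (ht : t ∈ Icc (0 : ℝ) 1) (hy : y ∈ s) (hyt : y + t • X y h ∈ s)
    (hsymm : fderiv ℝ X y (X y u) h = fderiv ℝ X y (X y h) u) (hδ : ‖u + h‖ ≤ δ) :
    ‖X y u + (X y h + t • fderiv ℝ X y (X y u) h) - X (y + t • X y h) (u + h)‖ ≤
      (m ^ 2 + m ^ 3 * δ) * ‖h‖ ^ 2 := by
  set z := y + t • X y h with hz
  have hXh : ‖X y h‖ ≤ m * ‖h‖ := (X y).le_of_opNorm_le (hX.norm_le y hy) h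
  have hzy : ‖z - y‖ ≤ m * ‖h‖ := by
    rw [hz, add_sub_cancel_left, norm_smul, Real.norm_of_nonneg ht.1]
    exact (mul_le_of_le_one_left (norm_nonneg _) ht.2).trans hXh
  have hsplit : X y u + (X y h + t • fderiv ℝ X y (X y u) h) - X z (u + h) =
      -(t • fderiv ℝ X y (X y h) h) - (X z - X y - fderiv ℝ X y (z - y)) (u + h) := by
    simp only [hz, hsymm, add_sub_cancel_left, sub_apply, map_add, map_smul, smul_apply]
    abel
  have hsecond : ‖t • fderiv ℝ X y (X y h) h‖ ≤ m ^ 2 * ‖h‖ ^ 2 := by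
    rw [norm_smul, Real.norm_of_nonneg ht.1]
    refine (mul_le_of_le_one_left (norm_nonneg _) ht.2).trans ?_
    calc ‖fderiv ℝ X y (X y h) h‖ ≤ m * (m * ‖h‖) * ‖h‖ :=
          ContinuousLinearMap.le_of_opNorm_le _
            ((fderiv ℝ X y).le_of_opNorm_le_of_le (hX.norm_fderiv_le y hy) hXh) h
      _ = m ^ 2 * ‖h‖ ^ 2 := by ring
  have htaylor : ‖(X z - X y - fderiv ℝ X y (z - y)) (u + h)‖ ≤ m ^ 3 * δ * ‖h‖ ^ 2 :=
    calc _ ≤ (m * (m * ‖h‖) ^ 2) * δ := by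
          refine ContinuousLinearMap.le_of_opNorm_le_of_le _ ?_ hδ
          exact (norm_sub_sub_fderiv_le hs hX.differentiableAt hX.lipschitzOnWith_fderiv hy
            hyt).trans (by gcongr)
      _ = m ^ 3 * δ * ‖h‖ ^ 2 := by ring
  rw [hsplit, add_mul]
  exact (norm_sub_le _ _).trans (by rw [norm_neg]; exact add_le_add hsecond htaylor)

theorem IsFlowLine.norm_sub_sub_le {X : E → W →L[ℝ] E} {s : Set E} {m δ : ℝ≥0} {x₀ : E}
    {u h : W} {γ η : ℝ → E} (hγ : IsFlowLine X s x₀ u γ) (hη : IsFlowLine X s x₀ (u + h) η)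
    (hX : IsC11BoundedOn X s m) (hs : Convex ℝ s) (hδ : ‖u + h‖ ≤ δ)
    (hmem : ∀ t ∈ Icc (0 : ℝ) 1, γ t + t • X (γ t) h ∈ s)
    (hsymm : ∀ t ∈ Icc (0 : ℝ) 1,
      fderiv ℝ X (γ t) (X (γ t) u) h = fderiv ℝ X (γ t) (X (γ t) h) u) :
    ‖η 1 - γ 1 - X (γ 1) h‖ ≤
      (m ^ 2 + m ^ 3 * δ) * gronwallBound 0 (m * δ) 1 1 * ‖h‖ ^ 2 := by
  have hvar := fun t ht => hγ.hasDerivWithinAt_add_smul (h := h) hX.differentiableAt ht (t := t)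
  have hdist := dist_le_of_approx_trajectories_ODE_of_mem (v := fun _ y => X y (u + h))
    (s := fun _ => s) (K := m * δ) (a := 0) (b := 1) (δ := 0) (εg := 0)
    (εf := (m ^ 2 + m ^ 3 * δ) * ‖h‖ ^ 2)
    (fun _ _ => hX.lipschitzOnWith_apply hs hδ)
    (fun t ht => (hvar t ht).continuousWithinAt)
    (fun t ht => (hvar t (Ico_subset_Icc_self ht)).mono_of_mem_nhdsWithin
      (Icc_mem_nhdsGE_of_mem ht))
    (fun t ht => by
      have ht' := Ico_subset_Icc_self ht
      rw [dist_eq_norm]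
      exact hX.norm_variation_sub_le hs ht' (hγ.mem t ht') (hmem t ht') (hsymm t ht') hδ)
    (fun t ht => hmem t (Ico_subset_Icc_self ht))
    hη.isIntegralCurveOn.continuousOn (fun t ht => hη.hasDerivWithinAt_Ici ht)
    (fun t _ => (dist_self _).le) (fun t ht => hη.mem t (Ico_subset_Icc_self ht))
    (by simp [hγ.map_zero, hη.map_zero]) 1 (by simp)
  rw [dist_comm, dist_eq_norm, gronwallBound_zero_eq_mul] at hdist
  calc ‖η 1 - γ 1 - X (γ 1) h‖ = ‖η 1 - (γ 1 + (1 : ℝ) • X (γ 1) h)‖ := by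
        rw [one_smul, sub_sub]
    _ ≤ _ := hdist
    _ = _ := by push_cast; ring_nf

theorem IsC11BoundedOn.exists_isFlowLine [CompleteSpace E] {X : E → W →L[ℝ] E} {x₀ : E}
    {b m δ : ℝ≥0} (hX : IsC11BoundedOn X (closedBall x₀ b) m) (hmδ : m * δ ≤ b) {u : W}
    (hu : ‖u‖ ≤ δ) : ∃ γ : ℝ → E, IsFlowLine X (closedBall x₀ b) x₀ u γ := by
  obtain ⟨γ, h0, hmem, hγ⟩ := exists_isIntegralCurveOn_mem_closedBall (v := fun y => X y u)
    (L := m * δ) (fun y hy => by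
      push_cast
      exact (X y).le_of_opNorm_le_of_le (hX.norm_le y hy) hu)
    (hX.lipschitzOnWith_apply (convex_closedBall x₀ b) hu) hmδ
  exact ⟨γ, h0, hmem, hγ⟩

theorem hasFDerivAt_of_eventually_norm_sub_le_sq {f : W → E} {f' : W →L[ℝ] E} {u : W} {C : ℝ}
    (h : ∀ᶠ k in 𝓝 0, ‖f (u + k) - f u - f' k‖ ≤ C * ‖k‖ ^ 2) : HasFDerivAt f f' u := by
  rw [hasFDerivAt_iff_isLittleO_nhds_zero]
  refine (Asymptotics.IsBigO.of_bound C (g := fun k : W => ‖k‖ ^ 2) ?_).trans_isLittleO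
    (Asymptotics.isLittleO_norm_pow_id one_lt_two)
  simpa using h

/-- The total differential equation `df = X ∘ f` is solved by `f u = exp (X · u) x₀`; the
compatibility condition is needed along the flow lines only. -/
theorem exists_hasFDerivAt_eq_comp [CompleteSpace E] {X : E → W →L[ℝ] E} {x₀ : E}
    (hX : ContDiffAt ℝ 2 X x₀) {Ω : Set E} (hΩ : Ω ∈ 𝓝 x₀)
    (hsymm : ∀ (u : W) (γ : ℝ → E), IsFlowLine X Ω x₀ u γ → ∀ t ∈ Icc (0 : ℝ) 1, ∀ v w,
      fderiv ℝ X (γ t) (X (γ t) v) w = fderiv ℝ X (γ t) (X (γ t) w) v) :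
    ∃ δ > 0, ∃ f : W → E, ∀ u ∈ ball (0 : W) δ,
      (∃ γ, IsFlowLine X Ω x₀ u γ ∧ γ 1 = f u) ∧ HasFDerivAt f (X (f u)) u := by
  obtain ⟨r, m, hr, hΩr, hXr⟩ := exists_isC11BoundedOn_closedBall hX hΩ
  obtain ⟨b, rfl⟩ : ∃ b, r = b + b := ⟨r / 2, (add_halves r).symm⟩
  have hbr : closedBall x₀ (b : ℝ) ⊆ closedBall x₀ ((b + b : ℝ≥0) : ℝ) :=
    closedBall_subset_closedBall (by simp)
  have hb : 0 < b := by simpa using hr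
  obtain ⟨δ, hδ, hmδ⟩ : ∃ δ : ℝ≥0, 0 < δ ∧ m * δ ≤ b := by
    refine ⟨b / (m + 1), by positivity, ?_⟩
    rw [mul_div_assoc', div_le_iff₀ (by positivity), mul_comm]
    gcongr
    exact le_self_add
  choose! γ hγ using fun u (hu : ‖u‖ ≤ δ) => (hXr.mono hbr).exists_isFlowLine hmδ hu
  refine ⟨δ, hδ, fun u => γ u 1, fun u hu => ?_⟩
  have huδ : ‖u‖ < δ := by simpa using hu
  have hγu := hγ u huδ.le
  refine ⟨⟨γ u, hγu.mono (hbr.trans hΩr), rfl⟩, ?_⟩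
  have hnear : ∀ᶠ h : W in 𝓝 0, ‖u + h‖ < δ ∧ m * ‖h‖ < b := by
    refine .and (ContinuousAt.eventually_lt (by fun_prop) continuousAt_const (by simpa))
      (ContinuousAt.eventually_lt (by fun_prop) continuousAt_const (by simpa))
  refine hasFDerivAt_of_eventually_norm_sub_le_sq
    (C := (m ^ 2 + m ^ 3 * δ) * gronwallBound 0 (m * δ) 1 1) (hnear.mono fun h hh => ?_)
  refine (hγu.mono hbr).norm_sub_sub_le ((hγ (u + h) hh.1.le).mono hbr) hXr
    (convex_closedBall _ _) hh.1.le (fun t ht => ?_)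
    fun t ht => hsymm u (γ u) (hγu.mono (hbr.trans hΩr)) t ht u h
  have hvar : ‖t • X (γ u t) h‖ ≤ b := by
    rw [norm_smul, Real.norm_of_nonneg ht.1]
    refine (mul_le_of_le_one_left (norm_nonneg _) ht.2).trans (le_trans ?_ hh.2.le)
    exact (X (γ u t)).le_of_opNorm_le (hXr.norm_le _ (hbr (hγu.mem t ht))) h
  rw [mem_closedBall, dist_eq_norm, add_sub_right_comm]
  push_cast
  exact (norm_add_le _ _).trans (add_le_add (by simpa [dist_eq_norm] using hγu.mem t ht) hvar)

theorem contDiffOn_infty_of_hasFDerivAt_comp {f : W → E} {X : E → W →L[ℝ] E} {U : Set W}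
    {Ω : Set E} (hU : IsOpen U) (hX : ContDiffOn ℝ ∞ X Ω) (hmaps : MapsTo f U Ω)
    (hf : ∀ u ∈ U, HasFDerivAt f (X (f u)) u) : ContDiffOn ℝ ∞ f U := by
  refine contDiffOn_infty.2 fun n => ?_
  induction n with
  | zero => exact contDiffOn_zero.2 fun u hu => (hf u hu).continuousAt.continuousWithinAt
  | succ n ih =>
    rw [Nat.cast_succ, contDiffOn_succ_iff_fderiv_of_isOpen hU]
    refine ⟨fun u hu => (hf u hu).differentiableAt.differentiableWithinAt, by simp, ?_⟩
    exact ((contDiffOn_infty.1 hX n).comp ih hmaps).congr fun u hu => (hf u hu).fderiv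

end TotalDifferential

/-! ### Involutive families of vector fields -/

section Involutive

open Set Metric Filter Topology

variable {E A B W F : Type*} [NormedAddCommGroup E] [NormedSpace ℝ E] [NormedAddCommGroup A]
  [NormedSpace ℝ A] [NormedAddCommGroup B] [NormedSpace ℝ B] [NormedAddCommGroup W]
  [NormedSpace ℝ W] [NormedAddCommGroup F] [NormedSpace ℝ F]

/-- `r` is a smooth retraction of the open set `Ω` into `M`. It need not map `Ω` to itself, so that
`Ω` may be shrunk freely. -/
structure IsSmoothRetraction (r : E → E) (Ω M : Set E) : Prop where
  isOpen : IsOpen Ω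
  contDiffOn : ContDiffOn ℝ ∞ r Ω
  mapsTo : MapsTo r Ω M
  map_eq : ∀ y ∈ M, y ∈ Ω → r y = y

/-- Every point of `M` has a neighbourhood that retracts smoothly into `M`; this is how embedded
submanifolds are encoded here. -/
def IsLocalSmoothRetract (M : Set E) : Prop :=
  ∀ x ∈ M, ∃ (Ω : Set E) (r : E → E), x ∈ Ω ∧ IsSmoothRetraction r Ω M

theorem differentiableAt_of_contDiffOn_isOpen {g : E → F} {Ω : Set E}
    (hg : ContDiffOn ℝ ∞ g Ω) (hΩ : IsOpen Ω) {y : E} (hy : y ∈ Ω) : DifferentiableAt ℝ g y :=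
  (hg.contDiffAt (hΩ.mem_nhds hy)).differentiableAt (by simp)

namespace IsSmoothRetraction

variable {r : E → E} {Ω M : Set E} {y v : E}

theorem mono (hr : IsSmoothRetraction r Ω M) {Ω' : Set E} (hΩ' : IsOpen Ω') (h : Ω' ⊆ Ω) :
    IsSmoothRetraction r Ω' M :=
  ⟨hΩ', hr.contDiffOn.mono h, hr.mapsTo.mono_left h, fun y hy hy' => hr.map_eq y hy (h hy')⟩

theorem hasFDerivAt (hr : IsSmoothRetraction r Ω M) (hy : y ∈ Ω) :
    HasFDerivAt r (fderiv ℝ r y) y :=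
  (differentiableAt_of_contDiffOn_isOpen hr.contDiffOn hr.isOpen hy).hasFDerivAt

theorem fderiv_apply (hr : IsSmoothRetraction r Ω M) (hy : y ∈ M) (hyΩ : y ∈ Ω)
    (hv : v ∈ tangentConeAt ℝ M y) : fderiv ℝ r y v = v := by
  have hid : HasFDerivWithinAt r (ContinuousLinearMap.id ℝ E) M y :=
    (hasFDerivWithinAt_id y M).congr_of_eventuallyEq
      (eventually_of_mem (inter_mem_nhdsWithin M (hr.isOpen.mem_nhds hyΩ))
        fun z hz => hr.map_eq z hz.1 hz.2) (hr.map_eq y hy hyΩ)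
  exact (hr.hasFDerivAt hyΩ).hasFDerivWithinAt.unique_on hid hv

theorem fderiv_comp_apply (hr : IsSmoothRetraction r Ω M) (hy : y ∈ M) (hyΩ : y ∈ Ω)
    (hv : v ∈ tangentConeAt ℝ M y) {g : E → F} {g' : E →L[ℝ] F}
    (hg : HasFDerivWithinAt g g' M y) : fderiv ℝ (g ∘ r) y v = g' v := by
  rw [← hr.map_eq y hy hyΩ] at hg
  have hcomp : HasFDerivWithinAt (g ∘ r) (g' ∘L fderiv ℝ r y) Ω y :=
    hg.comp y (hr.hasFDerivAt hyΩ).hasFDerivWithinAt hr.mapsTo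
  rw [(hcomp.hasFDerivAt (hr.isOpen.mem_nhds hyΩ)).fderiv, ContinuousLinearMap.comp_apply,
    hr.fderiv_apply hy hyΩ hv]

/-- The defect `y - r y` satisfies a linear differential inequality along the flow lines, because
its derivative along `X` is Lipschitz and vanishes on `M`. -/
theorem exists_nhds_flowLine_mem (hr : IsSmoothRetraction r Ω M) {X : E → W →L[ℝ] E}
    (hX : ContDiffOn ℝ ∞ X Ω)
    (htan : ∀ y ∈ M, y ∈ Ω → ∀ u, X y u ∈ tangentConeAt ℝ M y) {x₀ : E} (hx₀ : x₀ ∈ M)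
    (hx₀Ω : x₀ ∈ Ω) :
    ∃ U ∈ 𝓝 x₀, U ⊆ Ω ∧ ∀ u γ, IsFlowLine X U x₀ u γ → ∀ t ∈ Icc (0 : ℝ) 1, γ t ∈ M := by
  set h : E → W →L[ℝ] E := fun y => X y - fderiv ℝ r y ∘L X y with hh
  have hh_smooth : ContDiffOn ℝ ∞ h Ω :=
    hX.sub ((hr.contDiffOn.fderiv_of_isOpen hr.isOpen (by simp)).clm_comp hX)
  have hh_zero : ∀ y ∈ M, y ∈ Ω → h y = 0 := fun y hy hyΩ => by
    ext u
    simp [hh, hr.fderiv_apply hy hyΩ (htan y hy hyΩ u)]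
  obtain ⟨κ, σ, hσ, hlip⟩ := ((hh_smooth.contDiffAt (hr.isOpen.mem_nhds hx₀Ω)).of_le
    (m := 1) (by norm_cast)).exists_lipschitzOnWith
  have hrx : r x₀ = x₀ := hr.map_eq x₀ hx₀ hx₀Ω
  have hΩσ : Ω ∩ σ ∈ 𝓝 x₀ := inter_mem (hr.isOpen.mem_nhds hx₀Ω) hσ
  have hrΩσ : r ⁻¹' (Ω ∩ σ) ∈ 𝓝 x₀ :=
    (hr.hasFDerivAt hx₀Ω).continuousAt.preimage_mem_nhds (by rwa [hrx])
  refine ⟨_, inter_mem hΩσ hrΩσ, fun y hy => hy.1.1, fun u γ hγ t ht => ?_⟩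
  have hzero : γ t - r (γ t) = 0 :=
    hγ.eq_zero_of_norm_fderiv_le (G := fun y => y - r y) (C := κ * ‖u‖)
      (fun y hy => differentiableAt_id.sub (hr.hasFDerivAt hy.1.1).differentiableAt)
      (by simp [hrx]) (fun t ht => by
        have hmem := hγ.mem t ht
        have hderiv : fderiv ℝ (fun y => y - r y) (γ t) (X (γ t) u) = h (γ t) u :=
          congr($(((hasFDerivAt_id _).fun_sub (hr.hasFDerivAt hmem.1.1)).fderiv) _)
        have hle := hlip.norm_sub_le hmem.1.2 hmem.2.2
        rw [hh_zero _ (hr.mapsTo hmem.1.1) hmem.2.1, sub_zero] at hle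
        calc _ ≤ κ * ‖γ t - r (γ t)‖ * ‖u‖ := hderiv ▸ (h (γ t)).le_of_opNorm_le hle u
          _ = _ := by ring) t ht
  rw [sub_eq_zero.1 hzero]
  exact hr.mapsTo (hγ.mem t ht).1.1

end IsSmoothRetraction

theorem exists_section_projection [FiniteDimensional ℝ E] [FiniteDimensional ℝ A]
    (T : A →L[ℝ] E) :
    ∃ (d : ℕ) (s : EuclideanSpace ℝ (Fin d) →L[ℝ] A) (p : E →L[ℝ] EuclideanSpace ℝ (Fin d)),
      (∀ w, p (T (s w)) = w) ∧ ∀ c, T (s (p (T c))) = T c := by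
  let R : Submodule ℝ E := (T : A →ₗ[ℝ] E).range
  let φ : EuclideanSpace ℝ (Fin (Module.finrank ℝ R)) ≃L[ℝ] R :=
    ContinuousLinearEquiv.ofFinrankEq (by simp)
  obtain ⟨s, hs⟩ := (T : A →ₗ[ℝ] E).rangeRestrict.exists_rightInverse_of_surjective
    (LinearMap.range_rangeRestrict _)
  obtain ⟨q, hq⟩ := R.subtype.exists_leftInverse_of_injective R.ker_subtype
  have hs' (w : R) : T (s w) = w := congrArg Subtype.val (LinearMap.congr_fun hs w)
  have hq' (w : R) : q w = w := LinearMap.congr_fun hq w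
  refine ⟨Module.finrank ℝ R, s.toContinuousLinearMap ∘L (φ : _ →L[ℝ] R),
    (φ.symm : R →L[ℝ] _) ∘L q.toContinuousLinearMap, fun w => ?_, fun c => ?_⟩
  · simp [hs', hq']
  · simp [hs', show q (T c) = ⟨T c, c, rfl⟩ from hq' ⟨T c, c, rfl⟩]

theorem contDiffOn_ringInverse_comp {R : Type*} [NormedRing R] [NormedAlgebra ℝ R]
    [HasSummableGeomSeries R] {n : WithTop ℕ∞} {g : E → R}
    {s : Set E} (hg : ContDiffOn ℝ n g s) (hu : ∀ x ∈ s, IsUnit (g x)) :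
    ContDiffOn ℝ n (fun x => Ring.inverse (g x)) s := by
  intro x hx
  obtain ⟨u, hu⟩ := hu x hx
  exact (hu ▸ contDiffAt_ringInverse ℝ u).comp_contDiffWithinAt x (hg x hx)

/-- A smooth choice `a` of coefficients for which `R y ∘ a y` is a frame of a subspace of the range
of `R y`, normalized by the fixed projection `p`; at `x₀` it spans the whole range. -/
structure IsAdaptedFrame (R : E → A →L[ℝ] E) (Ω : Set E) (x₀ : E) (p : E →L[ℝ] W)
    (a : E → W →L[ℝ] A) : Prop where
  isOpen : IsOpen Ω
  contDiffOn : ContDiffOn ℝ ∞ R Ω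
  contDiffOn_coeff : ContDiffOn ℝ ∞ a Ω
  proj_apply : ∀ y ∈ Ω, ∀ w, p (R y (a y w)) = w
  apply_proj : ∀ c, R x₀ (a x₀ (p (R x₀ c))) = R x₀ c

theorem exists_isAdaptedFrame [FiniteDimensional ℝ E] [FiniteDimensional ℝ A]
    {R : E → A →L[ℝ] E} {Ω : Set E} (hΩ : IsOpen Ω) (hR : ContDiffOn ℝ ∞ R Ω) {x₀ : E}
    (hx₀ : x₀ ∈ Ω) :
    ∃ (d : ℕ) (p : E →L[ℝ] EuclideanSpace ℝ (Fin d)) (a : E → EuclideanSpace ℝ (Fin d) →L[ℝ] A)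
      (Ω' : Set E), Ω' ⊆ Ω ∧ x₀ ∈ Ω' ∧ IsAdaptedFrame R Ω' x₀ p a := by
  obtain ⟨d, s, p, hps, hsp⟩ := exists_section_projection (R x₀)
  set P : E → EuclideanSpace ℝ (Fin d) →L[ℝ] EuclideanSpace ℝ (Fin d) :=
    fun y => p ∘L R y ∘L s
  have hP_smooth : ContDiffOn ℝ ∞ P Ω :=
    contDiffOn_const.clm_comp (hR.clm_comp contDiffOn_const)
  have hP_one : P x₀ = 1 := ContinuousLinearMap.ext hps
  refine ⟨d, p, fun y => s ∘L Ring.inverse (P y), Ω ∩ P ⁻¹' {q | IsUnit q}, inter_subset_left,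
    ⟨hx₀, by simp [hP_one]⟩, hP_smooth.continuousOn.isOpen_inter_preimage hΩ Units.isOpen,
    hR.mono inter_subset_left, contDiffOn_const.clm_comp <|
      contDiffOn_ringInverse_comp (hP_smooth.mono inter_subset_left) fun y hy => hy.2,
    fun y hy w => DFunLike.congr_fun (Ring.mul_inverse_cancel (P y) hy.2) w,
    fun c => by simp [hP_one, hsp]⟩

/-- `e` expresses the brackets of the vector fields `R · c` in terms of these fields. -/
structure IsStructureMap (R : E → A →L[ℝ] E) (e : E → A →L[ℝ] A →L[ℝ] A) (S : Set E) : Prop where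
  continuousOn : ContinuousOn e S
  bracket : ∀ y ∈ S, ∀ c d,
    fderiv ℝ R y (R y c) d - fderiv ℝ R y (R y d) c = R y (e y c d)

theorem IsStructureMap.mono {R : E → A →L[ℝ] E} {e : E → A →L[ℝ] A →L[ℝ] A} {S S' : Set E}
    (he : IsStructureMap R e S) (h : S' ⊆ S) : IsStructureMap R e S' :=
  ⟨he.continuousOn.mono h, fun y hy => he.bracket y (h hy)⟩

theorem IsStructureMap.bracket_comp {R : E → A →L[ℝ] E} {e : E → A →L[ℝ] A →L[ℝ] A} {S : Set E}
    (he : IsStructureMap R e S) {y : E} (hy : y ∈ S) (hR : DifferentiableAt ℝ R y)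
    {a : E → W →L[ℝ] A} {b : E → B →L[ℝ] A} (ha : DifferentiableAt ℝ a y)
    (hb : DifferentiableAt ℝ b y) (w : W) (c : B) :
    fderiv ℝ (fun z => R z ∘L b z) y (R y (a y w)) c -
        fderiv ℝ (fun z => R z ∘L a z) y (R y (b y c)) w =
      R y (e y (a y w) (b y c) + fderiv ℝ b y (R y (a y w)) c -
        fderiv ℝ a y (R y (b y c)) w) := by
  rw [(hR.hasFDerivAt.clm_comp hb.hasFDerivAt).fderiv,
    (hR.hasFDerivAt.clm_comp ha.hasFDerivAt).fderiv, map_sub, map_add, ← he.bracket y hy]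
  simp only [add_apply, ContinuousLinearMap.comp_apply, ContinuousLinearMap.compL_apply,
    ContinuousLinearMap.flip_apply]
  abel

theorem apply_fderiv_eq_zero_of_comp_eq {p : E →L[ℝ] W} {g : E → B →L[ℝ] E} {T : B →L[ℝ] W}
    {Ω : Set E} (hΩ : IsOpen Ω) (hg : ContDiffOn ℝ ∞ g Ω) (hpg : ∀ y ∈ Ω, p ∘L g y = T) {y : E}
    (hy : y ∈ Ω) (v : E) (c : B) : p (fderiv ℝ g y v c) = 0 := by
  have hcomp := (hasFDerivAt_const p y).clm_comp
    (differentiableAt_of_contDiffOn_isOpen hg hΩ hy).hasFDerivAt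
  have hconst : (fun z => p ∘L g z) =ᶠ[𝓝 y] fun _ => T :=
    eventually_of_mem (hΩ.mem_nhds hy) hpg
  simpa using congr($(hcomp.unique ((hasFDerivAt_const T y).congr_of_eventuallyEq hconst)) v c)

/-- The frame that the coefficients `a` single out among the fields `R · c`. -/
def frameField (R : E → A →L[ℝ] E) (a : E → W →L[ℝ] A) (y : E) : W →L[ℝ] E := R y ∘L a y

/-- The coefficients left over after subtracting from `c` those of the frame field that has the same
image as `R y c` under `p`. -/
def defectCoeff (R : E → A →L[ℝ] E) (p : E →L[ℝ] W) (a : E → W →L[ℝ] A) (y : E) : A →L[ℝ] A :=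
  .id ℝ A - a y ∘L p ∘L R y

/-- The part of `R y` that is not spanned by the frame. The leaf will be the set where it
vanishes. -/
def frameDefect (R : E → A →L[ℝ] E) (p : E →L[ℝ] W) (a : E → W →L[ℝ] A) : E → A →L[ℝ] E :=
  frameField R (defectCoeff R p a)

namespace IsAdaptedFrame

variable {R : E → A →L[ℝ] E} {Ω S : Set E} {x₀ y : E} {p : E →L[ℝ] W} {a : E → W →L[ℝ] A}
  {e : E → A →L[ℝ] A →L[ℝ] A}

theorem frameDefect_apply (R : E → A →L[ℝ] E) (p : E →L[ℝ] W) (a : E → W →L[ℝ] A) (y : E)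
    (c : A) : frameDefect R p a y c = R y c - frameField R a y (p (R y c)) := by
  simp [frameDefect, frameField, defectCoeff]

theorem contDiffOn_frameField (ha : IsAdaptedFrame R Ω x₀ p a) :
    ContDiffOn ℝ ∞ (frameField R a) Ω :=
  ha.contDiffOn.clm_comp ha.contDiffOn_coeff

theorem contDiffOn_defectCoeff (ha : IsAdaptedFrame R Ω x₀ p a) :
    ContDiffOn ℝ ∞ (defectCoeff R p a) Ω :=
  contDiffOn_const.sub (ha.contDiffOn_coeff.clm_comp (contDiffOn_const.clm_comp ha.contDiffOn))

theorem contDiffOn_frameDefect (ha : IsAdaptedFrame R Ω x₀ p a) :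
    ContDiffOn ℝ ∞ (frameDefect R p a) Ω :=
  ha.contDiffOn.clm_comp ha.contDiffOn_defectCoeff

theorem proj_comp_frameField (ha : IsAdaptedFrame R Ω x₀ p a) (hy : y ∈ Ω) :
    p ∘L frameField R a y = .id ℝ W :=
  ContinuousLinearMap.ext (ha.proj_apply y hy)

theorem proj_comp_frameDefect (ha : IsAdaptedFrame R Ω x₀ p a) (hy : y ∈ Ω) :
    p ∘L frameDefect R p a y = 0 := by
  ext1 c
  have hp := congr($(ha.proj_comp_frameField hy) (p (R y c)))
  simp only [ContinuousLinearMap.comp_apply, ContinuousLinearMap.id_apply] at hp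
  simp [frameDefect_apply, hp]

theorem frameDefect_base (ha : IsAdaptedFrame R Ω x₀ p a) : frameDefect R p a x₀ = 0 := by
  ext1 c
  simp [frameDefect_apply, frameField, ha.apply_proj]

theorem apply_eq_frameDefect {c : A} (hc : p (R y c) = 0) : R y c = frameDefect R p a y c := by
  simp [frameDefect_apply, hc]

theorem range_frameField_of_frameDefect_eq_zero (h : frameDefect R p a y = 0) :
    (frameField R a y).range = (R y).range := by
  refine le_antisymm ?_ ?_
  · rintro _ ⟨w, rfl⟩
    exact ⟨a y w, rfl⟩
  · rintro _ ⟨c, rfl⟩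
    refine ⟨p (R y c), (sub_eq_zero.1 ?_).symm⟩
    exact (frameDefect_apply R p a y c).symm.trans congr($h c)

theorem fderiv_frameField_symm (ha : IsAdaptedFrame R Ω x₀ p a) (he : IsStructureMap R e S)
    (hy : y ∈ Ω) (hyS : y ∈ S) (h : frameDefect R p a y = 0) (v w : W) :
    fderiv ℝ (frameField R a) y (frameField R a y v) w =
      fderiv ℝ (frameField R a) y (frameField R a y w) v := by
  have hR := differentiableAt_of_contDiffOn_isOpen ha.contDiffOn ha.isOpen hy
  have hda := differentiableAt_of_contDiffOn_isOpen ha.contDiffOn_coeff ha.isOpen hy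
  have hbracket := he.bracket_comp hyS hR hda hda v w
  have hproj := apply_fderiv_eq_zero_of_comp_eq ha.isOpen ha.contDiffOn_frameField
    (fun _ => ha.proj_comp_frameField) hy
  have hzero := apply_eq_frameDefect (p := p) (a := a)
    (by rw [← hbracket, map_sub]; exact (sub_eq_zero.2 ((hproj _ _).trans (hproj _ _).symm)))
  rw [h, zero_apply, ← hbracket] at hzero
  exact sub_eq_zero.1 hzero

theorem fderiv_frameDefect_apply (ha : IsAdaptedFrame R Ω x₀ p a) (he : IsStructureMap R e S)
    (hy : y ∈ Ω) (hyS : y ∈ S) (u : W) (c : A) :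
    fderiv ℝ (frameDefect R p a) y (frameField R a y u) c =
      fderiv ℝ (frameField R a) y (frameDefect R p a y c) u +
        frameDefect R p a y (e y (a y u) (defectCoeff R p a y c) +
          fderiv ℝ (defectCoeff R p a) y (frameField R a y u) c -
          fderiv ℝ a y (frameDefect R p a y c) u) := by
  have hbracket := he.bracket_comp hyS
    (differentiableAt_of_contDiffOn_isOpen ha.contDiffOn ha.isOpen hy)
    (differentiableAt_of_contDiffOn_isOpen ha.contDiffOn_coeff ha.isOpen hy)
    (differentiableAt_of_contDiffOn_isOpen ha.contDiffOn_defectCoeff ha.isOpen hy) u c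
  have hpX := apply_fderiv_eq_zero_of_comp_eq ha.isOpen ha.contDiffOn_frameField
    (fun _ => ha.proj_comp_frameField) hy
  have hpZ := apply_fderiv_eq_zero_of_comp_eq ha.isOpen ha.contDiffOn_frameDefect
    (fun _ => ha.proj_comp_frameDefect) hy
  have hdefect := apply_eq_frameDefect (p := p) (a := a)
    (by rw [← hbracket, map_sub]; exact sub_eq_zero.2 ((hpZ _ _).trans (hpX _ _).symm))
  exact sub_eq_iff_eq_add'.1 (hbracket.trans hdefect)

theorem exists_fderiv_frameDefect_eq (ha : IsAdaptedFrame R Ω x₀ p a)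
    (he : IsStructureMap R e S) (u : W) :
    ∃ (T₁ : E → E →L[ℝ] E) (T₂ : E → A →L[ℝ] A), ContinuousOn T₁ (S ∩ Ω) ∧
      ContinuousOn T₂ (S ∩ Ω) ∧ ∀ y ∈ S ∩ Ω,
        fderiv ℝ (frameDefect R p a) y (frameField R a y u) =
          T₁ y ∘L frameDefect R p a y + frameDefect R p a y ∘L T₂ y := by
  have hsub : S ∩ Ω ⊆ Ω := inter_subset_right
  have hX := ha.contDiffOn_frameField.continuousOn.mono hsub
  have hZ := ha.contDiffOn_frameDefect.continuousOn.mono hsub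
  have hb := ha.contDiffOn_defectCoeff.continuousOn.mono hsub
  have ha_cont := ha.contDiffOn_coeff.continuousOn.mono hsub
  have hX' := (ha.contDiffOn_frameField.continuousOn_fderiv_of_isOpen ha.isOpen (by simp)).mono hsub
  have hb' :=
    (ha.contDiffOn_defectCoeff.continuousOn_fderiv_of_isOpen ha.isOpen (by simp)).mono hsub
  have ha' := (ha.contDiffOn_coeff.continuousOn_fderiv_of_isOpen ha.isOpen (by simp)).mono hsub
  have he_cont := he.continuousOn.mono (inter_subset_left (t := Ω))
  refine ⟨fun y => .apply ℝ E u ∘L fderiv ℝ (frameField R a) y,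
    fun y => e y (a y u) ∘L defectCoeff R p a y +
      fderiv ℝ (defectCoeff R p a) y (frameField R a y u) -
      .apply ℝ A u ∘L fderiv ℝ a y ∘L frameDefect R p a y,
    continuousOn_const.clm_comp hX', ?_, fun y hy => ?_⟩
  · exact (((he_cont.clm_apply (ha_cont.clm_apply continuousOn_const)).clm_comp hb).add
      (hb'.clm_apply (hX.clm_apply continuousOn_const))).sub
      (continuousOn_const.clm_comp (ha'.clm_comp hZ))
  · ext1 c
    exact ha.fderiv_frameDefect_apply he hy.2 hy.1 u c

theorem frameDefect_eq_zero_of_isFlowLine (ha : IsAdaptedFrame R Ω x₀ p a)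
    (he : IsStructureMap R e S) {u : W} {γ : ℝ → E} (hγ : IsFlowLine (frameField R a) Ω x₀ u γ)
    (hS : ∀ t ∈ Icc (0 : ℝ) 1, γ t ∈ S) :
    ∀ t ∈ Icc (0 : ℝ) 1, frameDefect R p a (γ t) = 0 := by
  obtain ⟨T₁, T₂, hT₁, hT₂, hT⟩ := ha.exists_fderiv_frameDefect_eq he u
  have hmaps : MapsTo γ (Icc 0 1) (S ∩ Ω) := fun t ht => ⟨hS t ht, hγ.mem t ht⟩
  have hγ_cont : ContinuousOn γ (Icc 0 1) := hγ.isIntegralCurveOn.continuousOn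
  obtain ⟨C₁, hC₁⟩ := isCompact_Icc.exists_bound_of_continuousOn (hT₁.comp hγ_cont hmaps)
  obtain ⟨C₂, hC₂⟩ := isCompact_Icc.exists_bound_of_continuousOn (hT₂.comp hγ_cont hmaps)
  refine hγ.eq_zero_of_norm_fderiv_le (C := C₁ + C₂) (fun y hy =>
    differentiableAt_of_contDiffOn_isOpen ha.contDiffOn_frameDefect ha.isOpen hy)
    ha.frameDefect_base fun t ht => ?_
  rw [hT _ (hmaps ht), add_mul, mul_comm C₂]
  exact (norm_add_le _ _).trans (add_le_add
    ((ContinuousLinearMap.opNorm_comp_le _ _).trans (by gcongr; exact hC₁ t ht))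
    ((ContinuousLinearMap.opNorm_comp_le _ _).trans (by gcongr; exact hC₂ t ht)))

end IsAdaptedFrame

theorem exists_continuousOn_clm_lift {X : Type*} [TopologicalSpace X] [FiniteDimensional ℝ A]
    {s : Set X} {L : X → B →L[ℝ] F} {g : X → A →L[ℝ] F}
    (h : ∀ c, ∃ e : X → B, ContinuousOn e s ∧ ∀ x ∈ s, L x (e x) = g x c) :
    ∃ e : X → A →L[ℝ] B, ContinuousOn e s ∧ ∀ x ∈ s, L x ∘L e x = g x := by
  choose e he hLe using h
  let b := Module.finBasis ℝ A
  let β (i) : A →L[ℝ] ℝ := (b.coord i).toContinuousLinearMap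
  refine ⟨fun x => ∑ i, (β i).smulRight (e (b i) x), continuousOn_finsetSum _ fun i _ =>
    (ContinuousLinearMap.smulRightL ℝ A B (β i)).continuous.comp_continuousOn (he (b i)),
    fun x hx => ContinuousLinearMap.coe_injective (b.ext fun j => ?_)⟩
  simp [β, Finsupp.single_apply, hLe _ x hx, ite_smul]

theorem IsSmoothRetraction.exists_isStructureMap [FiniteDimensional ℝ A] {r : E → E}
    {Ω M : Set E} {ρ : E → A →L[ℝ] E} (hr : IsSmoothRetraction r Ω M)
    (hρ : ContDiffOn ℝ ∞ ρ M) (htan : ∀ y ∈ M, ∀ c, ρ y c ∈ tangentConeAt ℝ M y)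
    (hinv : ∀ c d, ∃ e : E → A, ContinuousOn e M ∧ ∀ y ∈ M,
      VectorField.lieBracketWithin ℝ (fun z => ρ z c) (fun z => ρ z d) M y = ρ y (e y)) :
    ∃ e, IsStructureMap (ρ ∘ r) e (M ∩ Ω) := by
  set R := ρ ∘ r
  have hR : ContDiffOn ℝ ∞ R Ω := hρ.comp hr.contDiffOn hr.mapsTo
  have hRρ : ∀ y ∈ M ∩ Ω, R y = ρ y := fun y hy => congrArg ρ (hr.map_eq y hy.1 hy.2)
  let g (y : E) : A →L[ℝ] A →L[ℝ] E := fderiv ℝ R y ∘L R y - (fderiv ℝ R y ∘L R y).flip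
  have hg : ∀ y ∈ M ∩ Ω, ∀ c d, g y c d =
      VectorField.lieBracketWithin ℝ (fun z => ρ z c) (fun z => ρ z d) M y := by
    intro y hy c d
    have hderiv (c d : A) :
        fderiv ℝ R y (ρ y c) d = fderivWithin ℝ (fun z => ρ z d) M y (ρ y c) := by
      have hRy := differentiableAt_of_contDiffOn_isOpen hR hr.isOpen hy.2
      have hρd : DifferentiableWithinAt ℝ (fun z => ρ z d) M y :=
        ((hρ y hy.1).differentiableWithinAt (by simp)).clm_apply (differentiableWithinAt_const d)
      rw [← hr.fderiv_comp_apply hy.1 hy.2 (htan y hy.1 c) hρd.hasFDerivWithinAt]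
      change _ = fderiv ℝ (fun z => R z d) y _
      simp [fderiv_clm_apply hRy (differentiableAt_const d)]
    simp [g, hRρ y hy, hderiv, VectorField.lieBracketWithin]
  have hcurry : ∀ c, ∃ e : E → A →L[ℝ] A, ContinuousOn e (M ∩ Ω) ∧ ∀ y ∈ M ∩ Ω,
      ContinuousLinearMap.compL ℝ A A E (R y) (e y) = g y c := fun c => by
    refine exists_continuousOn_clm_lift fun d => ?_
    obtain ⟨e, he, hbracket⟩ := hinv c d
    exact ⟨e, he.mono inter_subset_left, fun y hy => by
      rw [hRρ y hy, hg y hy, hbracket y hy.1]⟩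
  obtain ⟨e, he, hRe⟩ := exists_continuousOn_clm_lift hcurry
  refine ⟨e, he, fun y hy c d => ?_⟩
  simpa [g] using congr($(hRe y hy) c d).symm

theorem isIntegralPatch_of_hasFDerivAt_comp {M : Set E} {D : E → Submodule ℝ E} {d : ℕ} {δ : ℝ}
    (hδ : 0 < δ) {Ω : Set E} {f : EuclideanSpace ℝ (Fin d) → E}
    {X : E → EuclideanSpace ℝ (Fin d) →L[ℝ] E} {p : E →L[ℝ] EuclideanSpace ℝ (Fin d)}
    (hX : ContDiffOn ℝ ∞ X Ω) (hpX : ∀ y ∈ Ω, p ∘L X y = .id ℝ _)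
    (hf : ∀ u ∈ ball 0 δ, HasFDerivAt f (X (f u)) u) (hΩ : MapsTo f (ball 0 δ) Ω)
    (hM : MapsTo f (ball 0 δ) M) (hD : ∀ u ∈ ball 0 δ, (X (f u)).range = D (f u)) :
    IsIntegralPatch M D (ball 0 δ) f where
  isOpen := isOpen_ball
  isConnected := (convex_ball _ _).isConnected (nonempty_ball.2 hδ)
  contDiffOn := contDiffOn_infty_of_hasFDerivAt_comp isOpen_ball hX hΩ hf
  mapsTo := hM
  injOn u hu v hv huv := by
    have hder : ∀ w ∈ ball 0 δ, HasFDerivWithinAt (p ∘ f) (.id ℝ _) (ball 0 δ) w := fun w hw =>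
      hpX _ (hΩ hw) ▸ (p.hasFDerivAt.comp w (hf w hw)).hasFDerivWithinAt
    have h := (convex_ball _ _).norm_image_sub_le_of_norm_hasFDerivWithin_le' (φ := .id ℝ _)
      (C := 0) hder (by simp) hv hu
    simpa [huv, sub_eq_zero, eq_comm] using h
  immersion u hu := by
    rw [(hf u hu).fderiv]
    exact Function.LeftInverse.injective (g := p) fun w => congr($(hpX _ (hΩ hu)) w)
  tangent u hu := by rw [(hf u hu).fderiv, hD u hu]

theorem exists_isIntegralPatch_of_involutive [FiniteDimensional ℝ E] [FiniteDimensional ℝ A]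
    {M : Set E} {D : E → Submodule ℝ E} {ρ : E → A →L[ℝ] E} (hret : IsLocalSmoothRetract M)
    (hρ : ContDiffOn ℝ ∞ ρ M) (hD : ∀ y ∈ M, (ρ y).range = D y)
    (htan : ∀ y ∈ M, ∀ c, ρ y c ∈ tangentConeAt ℝ M y)
    (hinv : ∀ c d, ∃ e : E → A, ContinuousOn e M ∧ ∀ y ∈ M,
      VectorField.lieBracketWithin ℝ (fun z => ρ z c) (fun z => ρ z d) M y = ρ y (e y))
    {x₀ : E} (hx₀ : x₀ ∈ M) :
    ∃ (d : ℕ) (U : Set (EuclideanSpace ℝ (Fin d))) (f : EuclideanSpace ℝ (Fin d) → E),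
      IsIntegralPatch M D U f ∧ x₀ ∈ f '' U := by
  obtain ⟨Ω, r, hx₀Ω, hr⟩ := hret x₀ hx₀
  obtain ⟨e, he⟩ := hr.exists_isStructureMap hρ htan hinv
  obtain ⟨d, p, a, Ω', hΩ', hx₀Ω', ha⟩ :=
    exists_isAdaptedFrame hr.isOpen (hρ.comp hr.contDiffOn hr.mapsTo) hx₀Ω
  have hRρ : ∀ y ∈ M, y ∈ Ω' → ρ (r y) = ρ y := fun y hy hyΩ =>
    congrArg ρ (hr.map_eq y hy (hΩ' hyΩ))
  set X := frameField (ρ ∘ r) a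
  obtain ⟨U, hU, hUΩ, hUM⟩ := (hr.mono ha.isOpen hΩ').exists_nhds_flowLine_mem
    ha.contDiffOn_frameField (fun y hy hyΩ u => by
      simpa [frameField, hRρ y hy hyΩ] using htan y hy (a y u)) hx₀ hx₀Ω'
  have hleaf : ∀ u γ, IsFlowLine X U x₀ u γ → ∀ t ∈ Icc (0 : ℝ) 1,
      γ t ∈ M ∧ γ t ∈ Ω' ∧ frameDefect (ρ ∘ r) p a (γ t) = 0 := fun u γ hγ t ht =>
    ⟨hUM u γ hγ t ht, hUΩ (hγ.mem t ht), ha.frameDefect_eq_zero_of_isFlowLine he (hγ.mono hUΩ)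
      (fun s hs => ⟨hUM u γ hγ s hs, hΩ' (hUΩ (hγ.mem s hs))⟩) t ht⟩
  obtain ⟨δ, hδ, f, hf⟩ := exists_hasFDerivAt_eq_comp (X := X)
    ((ha.contDiffOn_frameField.contDiffAt (ha.isOpen.mem_nhds hx₀Ω')).of_le (by norm_cast)) hU
    (fun u γ hγ t ht v w => by
      obtain ⟨hM, hΩt, hZ⟩ := hleaf u γ hγ t ht
      exact ha.fderiv_frameField_symm he hΩt ⟨hM, hΩ' hΩt⟩ hZ v w)
  have hfleaf : ∀ u ∈ ball 0 δ,
      f u ∈ M ∧ f u ∈ Ω' ∧ frameDefect (ρ ∘ r) p a (f u) = 0 := fun u hu => by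
    obtain ⟨⟨γ, hγ, hγf⟩, -⟩ := hf u hu
    exact hγf ▸ hleaf u γ hγ 1 (by simp)
  refine ⟨d, ball 0 δ, f, isIntegralPatch_of_hasFDerivAt_comp hδ ha.contDiffOn_frameField
    (fun _ => ha.proj_comp_frameField) (fun u hu => (hf u hu).2) (fun u hu => (hfleaf u hu).2.1)
    (fun u hu => (hfleaf u hu).1) fun u hu => ?_, 0, mem_ball_self hδ, ?_⟩
  · obtain ⟨hM, hΩu, hZ⟩ := hfleaf u hu
    rw [IsAdaptedFrame.range_frameField_of_frameDefect_eq_zero hZ, ← hD _ hM]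
    exact congrArg (fun T : A →L[ℝ] E => T.range) (hRρ _ hM hΩu)
  · obtain ⟨⟨γ, hγ, hγf⟩, -⟩ := hf 0 (mem_ball_self hδ)
    rw [← hγf, hγ.map_one_of_zero]

/-- The generators `ρ · c` may become linearly dependent, so that the rank of `D` may drop. -/
theorem isIntegrableDistribution_of_involutive [FiniteDimensional ℝ E] [FiniteDimensional ℝ A]
    {M : Set E} {D : E → Submodule ℝ E} {ρ : E → A →L[ℝ] E} (hret : IsLocalSmoothRetract M)
    (hρ : ContDiffOn ℝ ∞ ρ M) (hD : ∀ y ∈ M, (ρ y).range = D y)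
    (htan : ∀ y ∈ M, ∀ c, ρ y c ∈ tangentConeAt ℝ M y)
    (hinv : ∀ c d, ∃ e : E → A, ContinuousOn e M ∧ ∀ y ∈ M,
      VectorField.lieBracketWithin ℝ (fun z => ρ z c) (fun z => ρ z d) M y = ρ y (e y)) :
    IsIntegrableDistribution M D := by
  refine ⟨fun x hx v hv => ?_,
    fun x hx => exists_isIntegralPatch_of_involutive hret hρ hD htan hinv hx⟩
  obtain ⟨c, rfl⟩ := (hD x hx).ge hv
  exact ⟨fun y => ρ y c, hρ.clm_apply contDiffOn_const, fun y hy => (hD y hy).le ⟨c, rfl⟩, rfl⟩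

end Involutive

/-! ### Skew projections and the geometry of the twistor space -/

section SkewProjection

theorem mul_star_mul_self {R : Type*} [Ring R] [StarRing R] [Algebra ℝ R] {ε : ℝ} {F : R}
    (hε : ε * ε = 1) (hF : star F = ε • F) (C : R) :
    F * star C * F = star (F * C * F) := by
  rw [star_mul, star_mul, hF, smul_mul_assoc, mul_smul_comm, mul_smul_comm, smul_smul, hε,
    one_smul, mul_assoc]

variable {R : Type*} [NormedRing R] [NormedAlgebra ℝ R] [StarRing R] [ContinuousStar R]
  [StarModule ℝ R] {τ ε : ℝ} {k L F B : R}

/-- For `L` skew with `L² = -1`, the projection of a star algebra onto its skew elements that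
anticommute (`τ = 1`) or commute (`τ = -1`) with `L`. -/
noncomputable def skewProj (τ : ℝ) (L : R) : R →L[ℝ] R :=
  (1 / 4 : ℝ) • (ContinuousLinearMap.id ℝ R + τ • ContinuousLinearMap.mulLeftRight ℝ R L L) ∘L
    (ContinuousLinearMap.id ℝ R - ((starL' ℝ : R ≃L[ℝ] R) : R →L[ℝ] R))

theorem skewProj_apply (τ : ℝ) (L C : R) :
    skewProj τ L C = (1 / 4 : ℝ) • (C - star C + τ • (L * (C - star C) * L)) := by
  simp only [skewProj, ContinuousLinearMap.comp_apply, sub_apply, add_apply, smul_apply,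
    ContinuousLinearMap.id_apply, ContinuousLinearMap.mulLeftRight_apply,
    ContinuousLinearEquiv.coe_coe, starL'_apply]

theorem contDiff_skewProj {n : WithTop ℕ∞} : ContDiff ℝ n (skewProj (R := R) τ) := by
  unfold skewProj
  refine ((contDiff_const.add (ContDiff.const_smul τ ?_)).clm_comp contDiff_const).const_smul _
  exact ((ContinuousLinearMap.mulLeftRight ℝ R).contDiff).clm_apply contDiff_id

theorem star_skewProj (hL : star L = -L) (C : R) : star (skewProj τ L C) = -skewProj τ L C := by
  simp only [skewProj_apply, star_add, star_sub, star_smul, star_mul, star_star, hL, star_trivial]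
  rw [← smul_neg, neg_add, ← smul_neg]
  congr 2
  · abel
  · congr 1; noncomm_ring

theorem skewProj_mul (hτ : τ * τ = 1) (hL : L * L = -1) (C : R) :
    skewProj τ L C * L = -(τ • (L * skewProj τ L C)) := by
  rw [skewProj_apply]
  generalize C - star C = X
  have h1 : L * X * L * L = -(L * X) := by rw [mul_assoc, hL]; noncomm_ring
  have h2 : L * (L * X * L) = -(X * L) := by
    calc _ = (L * L) * X * L := by noncomm_ring
      _ = _ := by rw [hL]; noncomm_ring
  have h : (X + τ • (L * X * L)) * L = -(τ • (L * (X + τ • (L * X * L)))) := by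
    rw [add_mul, mul_add, smul_mul_assoc, h1, mul_smul_comm, h2, smul_add, smul_smul, hτ, one_smul,
      smul_neg, neg_add, neg_neg, add_comm]
  rw [smul_mul_assoc, h, mul_smul_comm, smul_comm τ, smul_neg]

theorem skewProj_eq_self_iff (hτ : τ * τ = 1) (hL : L * L = -1) (hs : star L = -L) :
    skewProj τ L B = B ↔ star B = -B ∧ B * L = -(τ • (L * B)) := by
  refine ⟨fun h => h ▸ ⟨star_skewProj hs B, skewProj_mul hτ hL B⟩, fun ⟨h1, h2⟩ => ?_⟩
  have h3 : L * (B + B) * L = τ • (B + B) := by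
    rw [mul_assoc, add_mul, h2, mul_add, mul_neg, mul_smul_comm, ← mul_assoc, hL]
    simp [smul_add]
  rw [skewProj_apply, h1, sub_neg_eq_add, h3, smul_smul, hτ]
  module

theorem skewProj_skewProj (hτ : τ * τ = 1) (hL : L * L = -1) (hs : star L = -L) (C : R) :
    skewProj τ L (skewProj τ L C) = skewProj τ L C :=
  (skewProj_eq_self_iff hτ hL hs).2 ⟨star_skewProj hs C, skewProj_mul hτ hL C⟩

theorem mul_skewProj_mul (hε : ε * ε = 1) (hF : star F = ε • F) (h1 : k * F = F * L)
    (h2 : F * k = L * F) (C : R) : F * skewProj τ L C * F = skewProj τ k (F * C * F) := by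
  have h3 : F * (L * (C - star C) * L) * F = k * (F * (C - star C) * F) * k := by
    calc _ = (F * L) * (C - star C) * (L * F) := by noncomm_ring
      _ = _ := by rw [← h1, ← h2]; noncomm_ring
  rw [skewProj_apply, skewProj_apply, mul_smul_comm, smul_mul_assoc, mul_add, add_mul,
    mul_smul_comm, smul_mul_assoc, h3, mul_sub, sub_mul, mul_star_mul_self hε hF]

/-- The map `C ↦ skewProj τ k (F * C * F)`. Its range consists of the skew elements that
anticommute (`τ = 1`) or commute (`τ = -1`) with `k` and kill `Ker F` and preserve `Im F`. -/
noncomputable def skewSandwich (τ : ℝ) (k F : R) : R →L[ℝ] R :=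
  skewProj τ k ∘L ContinuousLinearMap.mulLeftRight ℝ R F F

theorem skewSandwich_apply (τ : ℝ) (k F C : R) :
    skewSandwich τ k F C = skewProj τ k (F * C * F) := by
  simp [skewSandwich]

theorem contDiffOn_skewSandwich {E : Type*} [NormedAddCommGroup E] [NormedSpace ℝ E]
    {n : WithTop ℕ∞} {f g : E → R} {s : Set E} (hf : ContDiffOn ℝ n f s)
    (hg : ContDiffOn ℝ n g s) : ContDiffOn ℝ n (fun x => skewSandwich τ (f x) (g x)) s := by
  refine (contDiff_skewProj.comp_contDiffOn hf).clm_comp ?_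
  exact ((ContinuousLinearMap.mulLeftRight ℝ R).contDiff.comp_contDiffOn hg).clm_apply hg

end SkewProjection

section TwistorManifold

open Set Filter Topology

variable {V : Type*} [NormedAddCommGroup V] [InnerProductSpace ℝ V] [CompleteSpace V]
  {A B J K K₀ : V →L[ℝ] V}

theorem mem_skewEnd_iff : A ∈ skewEnd V ↔ star A = -A := by
  rw [ContinuousLinearMap.star_eq_adjoint, eq_comm, ContinuousLinearMap.eq_adjoint_iff]
  change (∀ v w : V, inner ℝ (A v) w = -inner ℝ v (A w)) ↔ _
  simp only [neg_apply, inner_neg_left]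
  exact forall₂_congr fun v w => neg_eq_iff_eq_neg.symm

theorem mem_twistorSpace_iff : K ∈ twistorSpace V ↔ K * K = -1 ∧ star K = -K := by
  rw [← mem_skewEnd_iff]
  change (_ ∧ ∀ v w : V, inner ℝ (K v) (K w) = inner ℝ v w) ↔
    _ ∧ ∀ v w : V, inner ℝ (K v) w = -inner ℝ v (K w)
  refine and_congr_right fun h => ⟨fun h' v w => ?_, fun h' v w => ?_⟩
  · have : K (K w) = -w := DFunLike.congr_fun h w
    rw [← neg_eq_iff_eq_neg, ← inner_neg_right, ← this, h']
  · have : K (K w) = -w := DFunLike.congr_fun h w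
    rw [h', this, inner_neg_right, neg_neg]

theorem mem_skewAnti_iff : A ∈ skewAnti K ↔ star A = -A ∧ A * K = -(K * A) := by
  rw [← mem_skewEnd_iff, ← add_eq_zero_iff_eq_neg]
  rfl

theorem mem_unitaryAlg_iff : B ∈ unitaryAlg J ↔ star B = -B ∧ B * J = J * B := by
  rw [← mem_skewEnd_iff, ← sub_eq_zero]
  rfl

theorem skewProj_one_eq_self_iff (hK : K ∈ twistorSpace V) :
    skewProj 1 K B = B ↔ B ∈ skewAnti K := by
  obtain ⟨hK2, hKs⟩ := mem_twistorSpace_iff.1 hK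
  rw [skewProj_eq_self_iff (one_mul 1) hK2 hKs, one_smul, mem_skewAnti_iff]

theorem skewProj_neg_one_eq_self_iff (hJ : J ∈ twistorSpace V) :
    skewProj (-1) J B = B ↔ B ∈ unitaryAlg J := by
  obtain ⟨hJ2, hJs⟩ := mem_twistorSpace_iff.1 hJ
  rw [skewProj_eq_self_iff (by norm_num) hJ2 hJs, neg_one_smul, neg_neg, mem_unitaryAlg_iff]

theorem skewProj_one_mem_skewAnti (hK : K ∈ twistorSpace V) (C : V →L[ℝ] V) :
    skewProj 1 K C ∈ skewAnti K := by
  obtain ⟨hK2, hKs⟩ := mem_twistorSpace_iff.1 hK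
  exact (skewProj_one_eq_self_iff hK).1 (skewProj_skewProj (one_mul 1) hK2 hKs C)

theorem skewProj_neg_one_mem_unitaryAlg (hJ : J ∈ twistorSpace V) (C : V →L[ℝ] V) :
    skewProj (-1) J C ∈ unitaryAlg J := by
  obtain ⟨hJ2, hJs⟩ := mem_twistorSpace_iff.1 hJ
  exact (skewProj_neg_one_eq_self_iff hJ).1 (skewProj_skewProj (by norm_num) hJ2 hJs C)

theorem commWith_mem_skewAnti (hK : K ∈ twistorSpace V) (hB : B ∈ skewEnd V) :
    commWith K B ∈ skewAnti K := by
  obtain ⟨hK2, hKs⟩ := mem_twistorSpace_iff.1 hK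
  rw [mem_skewEnd_iff] at hB
  change B * K - K * B ∈ _
  refine mem_skewAnti_iff.2 ⟨?_, ?_⟩
  · rw [star_sub, star_mul, star_mul, hB, hKs]; noncomm_ring
  · rw [sub_mul, mul_sub, mul_assoc, hK2, ← mul_assoc K K B, hK2]; noncomm_ring

theorem commutator_mem_unitaryAlg (hA : A ∈ unitaryAlg J) (hB : B ∈ unitaryAlg J) :
    A * B - B * A ∈ unitaryAlg J := by
  obtain ⟨hAs, hAJ⟩ := mem_unitaryAlg_iff.1 hA
  obtain ⟨hBs, hBJ⟩ := mem_unitaryAlg_iff.1 hB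
  refine mem_unitaryAlg_iff.2 ⟨?_, ?_⟩
  · rw [star_sub, star_mul, star_mul, hAs, hBs]; noncomm_ring
  · exact Commute.sub_left (Commute.mul_left hAJ hBJ) (Commute.mul_left hBJ hAJ)

/-- The Cayley transform `A ↦ (1 + A) K (1 + A)⁻¹`, which parametrizes the twistor space near `K`
by `skewAnti K`. -/
noncomputable def cayley (K A : V →L[ℝ] V) : V →L[ℝ] V := (1 + A) * K * Ring.inverse (1 + A)

theorem cayley_mem_twistorSpace (hK : K ∈ twistorSpace V) (hA : A ∈ skewAnti K)
    (hu : IsUnit (1 + A)) : cayley K A ∈ twistorSpace V := by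
  obtain ⟨hK2, hKs⟩ := mem_twistorSpace_iff.1 hK
  obtain ⟨hAs, hAK⟩ := mem_skewAnti_iff.1 hA
  have h1 : (1 + A) * Ring.inverse (1 + A) = 1 := Ring.mul_inverse_cancel _ hu
  have h2 : Ring.inverse (1 + A) * (1 + A) = 1 := Ring.inverse_mul_cancel _ hu
  have h3 : star (Ring.inverse (1 + A)) * (1 - A) = 1 := by
    simpa [hAs, ← sub_eq_add_neg] using congrArg star h1
  rw [cayley]
  generalize Ring.inverse (1 + A) = i at *
  refine mem_twistorSpace_iff.2 ⟨?_, ?_⟩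
  · calc (1 + A) * K * i * ((1 + A) * K * i) = (1 + A) * K * (i * (1 + A)) * K * i := by
          noncomm_ring
      _ = (1 + A) * (K * K) * i := by rw [h2]; noncomm_ring
      _ = -1 := by rw [hK2, mul_neg, mul_one, neg_mul, h1]
  · have hcomm : K * ((1 - A) * (1 + A)) = (1 - A) * (1 + A) * K := by
      have hA2 : A * A * K = K * (A * A) := by
        rw [mul_assoc, hAK, mul_neg, ← mul_assoc, hAK]; noncomm_ring
      calc K * ((1 - A) * (1 + A)) = K - K * (A * A) := by noncomm_ring
        _ = _ := by rw [← hA2]; noncomm_ring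
    have heq : star i * K * (1 - A) = (1 + A) * K * i := by
      calc star i * K * (1 - A) = star i * K * (1 - A) * ((1 + A) * i) := by rw [h1, mul_one]
        _ = star i * (K * ((1 - A) * (1 + A))) * i := by noncomm_ring
        _ = (star i * (1 - A)) * (1 + A) * K * i := by rw [hcomm]; noncomm_ring
        _ = _ := by rw [h3, one_mul]
    rw [← heq, star_mul, star_mul, star_star, star_sub, star_one, hAs, hKs, heq, sub_neg_eq_add]
    noncomm_ring

theorem inverse_add_mul_eq (hK₀ : K₀ ∈ twistorSpace V) (hK : K ∈ twistorSpace V)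
    (hu : IsUnit (K + K₀)) : Ring.inverse (K + K₀) * K₀ = K * Ring.inverse (K + K₀) := by
  have h : K₀ * (K + K₀) = (K + K₀) * K := by
    rw [add_mul, mul_add, (mem_twistorSpace_iff.1 hK).1, (mem_twistorSpace_iff.1 hK₀).1, add_comm]
  calc Ring.inverse (K + K₀) * K₀
      = Ring.inverse (K + K₀) * (K₀ * (K + K₀)) * Ring.inverse (K + K₀) := by
        rw [mul_assoc, mul_assoc K₀, Ring.mul_inverse_cancel _ hu, mul_one]
    _ = K * Ring.inverse (K + K₀) := by
        rw [h, ← mul_assoc, Ring.inverse_mul_cancel _ hu, one_mul]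

theorem sub_mul_inverse_add_mem_skewAnti (hK₀ : K₀ ∈ twistorSpace V) (hK : K ∈ twistorSpace V)
    (hu : IsUnit (K + K₀)) : (K - K₀) * Ring.inverse (K + K₀) ∈ skewAnti K₀ := by
  obtain ⟨hK2, hKs⟩ := mem_twistorSpace_iff.1 hK
  obtain ⟨hL2, hLs⟩ := mem_twistorSpace_iff.1 hK₀
  have h1 : (K + K₀) * Ring.inverse (K + K₀) = 1 := Ring.mul_inverse_cancel _ hu
  have h2 : Ring.inverse (K + K₀) * (K + K₀) = 1 := Ring.inverse_mul_cancel _ hu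
  have hi := inverse_add_mul_eq hK₀ hK hu
  generalize Ring.inverse (K + K₀) = i at *
  have hs : star i = -i := by
    have h3 : star i * (K + K₀) = -1 := by
      have := congrArg star h1
      rwa [star_mul, star_add, hKs, hLs, star_one, ← neg_add, mul_neg, neg_eq_iff_eq_neg] at this
    calc star i = star i * ((K + K₀) * i) := by rw [h1, mul_one]
      _ = _ := by rw [← mul_assoc, h3, neg_one_mul]
  refine mem_skewAnti_iff.2 ⟨?_, ?_⟩
  · have hc : (K - K₀) * (K + K₀) = -((K + K₀) * (K - K₀)) := by
      simp only [sub_mul, mul_add, add_mul, mul_sub, hK2, hL2]; abel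
    rw [star_mul, star_sub, hKs, hLs, hs]
    calc -i * (-K - -K₀) = i * ((K - K₀) * (K + K₀)) * i := by
          rw [mul_assoc, mul_assoc, h1]; noncomm_ring
      _ = -((i * (K + K₀)) * ((K - K₀) * i)) := by rw [hc]; noncomm_ring
      _ = _ := by rw [h2, one_mul]
  · have hd : K₀ * (K - K₀) = -((K - K₀) * K) := by
      rw [mul_sub, sub_mul, hK2, hL2]; noncomm_ring
    rw [mul_assoc, hi, ← mul_assoc, ← mul_assoc, hd]; noncomm_ring

theorem cayley_sub_mul_inverse_add (hK₀ : K₀ ∈ twistorSpace V) (hK : K ∈ twistorSpace V)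
    (hu : IsUnit (K + K₀)) (hu' : IsUnit (1 + (K - K₀) * Ring.inverse (K + K₀))) :
    cayley K₀ ((K - K₀) * Ring.inverse (K + K₀)) = K := by
  have hA : 1 + (K - K₀) * Ring.inverse (K + K₀) = 2 • (K * Ring.inverse (K + K₀)) := by
    nth_rw 1 [← Ring.mul_inverse_cancel _ hu]
    noncomm_ring
  have h : (1 + (K - K₀) * Ring.inverse (K + K₀)) * K₀ =
      K * (1 + (K - K₀) * Ring.inverse (K + K₀)) := by
    rw [hA, smul_mul_assoc, mul_assoc, inverse_add_mul_eq hK₀ hK hu, mul_smul_comm]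
  rw [cayley, h, mul_assoc, Ring.mul_inverse_cancel _ hu', mul_one]

theorem isLocalSmoothRetract_twistorSpace : IsLocalSmoothRetract (twistorSpace V) := by
  intro K₀ hK₀
  let Ω₁ : Set (V →L[ℝ] V) := {X | IsUnit (X + K₀)}
  -- Projecting the inverse Cayley transform to `skewAnti K₀` extends it off the twistor space.
  let α : (V →L[ℝ] V) → (V →L[ℝ] V) := fun X =>
    skewProj 1 K₀ ((X - K₀) * Ring.inverse (X + K₀))
  let Ω : Set (V →L[ℝ] V) := Ω₁ ∩ {X | IsUnit (1 + α X)}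
  have hα : ContDiffOn ℝ ∞ (fun X => 1 + α X) Ω₁ :=
    contDiffOn_const.add <| (skewProj 1 K₀).contDiff.comp_contDiffOn <|
      (contDiffOn_id.sub contDiffOn_const).mul <|
        contDiffOn_ringInverse_comp (contDiffOn_id.add contDiffOn_const) fun _ h => h
  have hα_eq : ∀ K ∈ twistorSpace V, K ∈ Ω₁ → α K = (K - K₀) * Ring.inverse (K + K₀) :=
    fun K hK hKΩ =>
      (skewProj_one_eq_self_iff hK₀).2 (sub_mul_inverse_add_mem_skewAnti hK₀ hK hKΩ)
  have hΩ : IsOpen Ω := hα.continuousOn.isOpen_inter_preimage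
    (Units.isOpen.preimage (continuous_id.add continuous_const)) Units.isOpen
  have hK₀Ω₁ : K₀ ∈ Ω₁ := by
    have hK₀2 := (mem_twistorSpace_iff.1 hK₀).1
    have hu : IsUnit K₀ := ⟨⟨K₀, -K₀, by simp [hK₀2], by simp [hK₀2]⟩, rfl⟩
    have h2 : K₀ + K₀ = Units.mk0 (2 : ℝ) two_ne_zero • K₀ := by rw [Units.smul_mk0, two_smul]
    change IsUnit (K₀ + K₀)
    exact h2 ▸ hu.smul (Units.mk0 (2 : ℝ) two_ne_zero)
  refine ⟨Ω, fun X => cayley K₀ (α X), ⟨hK₀Ω₁, ?_⟩, hΩ, ?_, ?_, ?_⟩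
  · simp [hα_eq K₀ hK₀ hK₀Ω₁]
  · have hα' := hα.mono (inter_subset_left : Ω ⊆ Ω₁)
    exact (hα'.mul contDiffOn_const).mul (contDiffOn_ringInverse_comp hα' fun _ h => h.2)
  · exact fun X hX => cayley_mem_twistorSpace hK₀ (skewProj_one_mem_skewAnti hK₀ _) hX.2
  · intro K hK hKΩ
    have h := hα_eq K hK hKΩ.1
    have hu : IsUnit (1 + α K) := hKΩ.2
    rw [h] at hu
    change cayley K₀ (α K) = K
    rw [h]
    exact cayley_sub_mul_inverse_add hK₀ hK hKΩ.1 hu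

theorem hasDerivAt_cayley_smul (K A : V →L[ℝ] V) :
    HasDerivAt (fun t : ℝ => cayley K (t • A)) (A * K - K * A) 0 := by
  have hadd : HasDerivAt (fun t : ℝ => 1 + t • A) A 0 := by
    simpa using ((hasDerivAt_id (0 : ℝ)).smul_const A).const_add 1
  have hinv : HasDerivAt (fun t : ℝ => Ring.inverse (1 + t • A)) (-A) 0 := by
    have h := hasFDerivAt_ringInverse (𝕜 := ℝ) (1 : (V →L[ℝ] V)ˣ)
    have e : ((1 : (V →L[ℝ] V)ˣ) : V →L[ℝ] V) = 1 + (0 : ℝ) • A := by simp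
    rw [e] at h
    simpa [Function.comp_def] using! h.comp_hasDerivAt (0 : ℝ) hadd
  simpa [cayley, sub_eq_add_neg] using! (hadd.mul_const K).mul hinv

theorem skewAnti_subset_tangentConeAt (hK : K ∈ twistorSpace V) :
    (skewAnti K : Set (V →L[ℝ] V)) ⊆ tangentConeAt ℝ (twistorSpace V) K := by
  intro B hB
  obtain ⟨hK2, hKs⟩ := mem_twistorSpace_iff.1 hK
  obtain ⟨hBs, hBK⟩ := mem_skewAnti_iff.1 hB
  let A : V →L[ℝ] V := -((1 / 2 : ℝ) • (B * K))
  have hA : A ∈ skewAnti K := by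
    refine neg_mem (Submodule.smul_mem _ _ (mem_skewAnti_iff.2 ⟨?_, ?_⟩))
    · rw [star_mul, hKs, hBs, hBK]; noncomm_ring
    · rw [hBK, neg_mul, mul_assoc, hBK]
  have hvel : A * K - K * A = B := by
    have h1 : K * (B * K) = B := by rw [hBK, mul_neg, ← mul_assoc, hK2]; simp
    have h2 : B * K * K = -B := by rw [mul_assoc, hK2]; simp
    rw [mul_neg, neg_mul, mul_smul_comm, smul_mul_assoc, h1, h2]
    module
  let U : Set ℝ := {t | IsUnit (1 + t • A)}
  have hU : U ∈ 𝓝 (0 : ℝ) :=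
    (Units.isOpen.preimage (by fun_prop : Continuous fun t : ℝ => 1 + t • A)).mem_nhds (by simp)
  have h1 : (1 : ℝ) ∈ tangentConeAt ℝ U 0 := by rw [tangentConeAt_of_mem_nhds hU]; trivial
  have h := (hasDerivAt_cayley_smul K A).hasDerivWithinAt.hasFDerivWithinAt.mapsTo_tangent_cone h1
  simp only [ContinuousLinearMap.toSpanSingleton_apply, one_smul, hvel] at h
  have h0 : cayley K ((0 : ℝ) • A) = K := by simp [cayley]
  rw [h0] at h
  refine tangentConeAt_mono ?_ h
  rintro _ ⟨t, ht, rfl⟩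
  exact cayley_mem_twistorSpace hK (Submodule.smul_mem _ t hA) ht

end TwistorManifold

section TangentialDerivative

open Set Filter Topology

variable {V : Type*} [NormedAddCommGroup V] [InnerProductSpace ℝ V]
  {W : Type*} [NormedAddCommGroup W] [NormedSpace ℝ W]
  {W' : Type*} [NormedAddCommGroup W'] [NormedSpace ℝ W']
  {f g : (V →L[ℝ] V) → W} {K X : V →L[ℝ] V}

theorem SmoothOnTwistor.hasFDerivWithinAt (hf : SmoothOnTwistor f) (hK : K ∈ twistorSpace V) :
    HasFDerivWithinAt f (fderivWithin ℝ f (twistorSpace V) K) (twistorSpace V) K :=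
  ((hf K hK).differentiableWithinAt (by simp)).hasFDerivWithinAt

theorem dTwistor_congr (hfg : EqOn f g (twistorSpace V)) (hK : K ∈ twistorSpace V) :
    dTwistor f K X = dTwistor g K X := by
  rw [dTwistor, dTwistor, fderivWithin_congr hfg (hfg hK)]

theorem dTwistor_const (w : W) : dTwistor (fun _ => w) K X = 0 := by
  simp [dTwistor]

variable [CompleteSpace V]

theorem dTwistor_eq_of_hasFDerivWithinAt {f' : (V →L[ℝ] V) →L[ℝ] W}
    (hf : HasFDerivWithinAt f f' (twistorSpace V) K) (hK : K ∈ twistorSpace V)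
    (hX : X ∈ skewAnti K) : dTwistor f K X = f' X :=
  hf.differentiableWithinAt.hasFDerivWithinAt.unique_on hf (skewAnti_subset_tangentConeAt hK hX)

theorem dTwistor_clm_comp (hf : SmoothOnTwistor f) (Λ : W →L[ℝ] W') (hK : K ∈ twistorSpace V)
    (hX : X ∈ skewAnti K) : dTwistor (fun K => Λ (f K)) K X = Λ (dTwistor f K X) :=
  dTwistor_eq_of_hasFDerivWithinAt
    (Λ.hasFDerivAt.comp_hasFDerivWithinAt K (hf.hasFDerivWithinAt hK)) hK hX

theorem SmoothOnTwistor.continuousOn_dTwistor (hf : SmoothOnTwistor f)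
    {Y : (V →L[ℝ] V) → (V →L[ℝ] V)} (hY : ContinuousOn Y (twistorSpace V))
    (hYt : ∀ K ∈ twistorSpace V, Y K ∈ skewAnti K) :
    ContinuousOn (fun K => dTwistor f K (Y K)) (twistorSpace V) := by
  intro K₀ hK₀
  obtain ⟨Ω, r, hK₀Ω, hr⟩ := isLocalSmoothRetract_twistorSpace K₀ hK₀
  have hfr : ContDiffOn ℝ ∞ (f ∘ r) Ω := ContDiffOn.comp hf hr.contDiffOn hr.mapsTo
  have hΩ : Ω ∈ 𝓝 K₀ := hr.isOpen.mem_nhds hK₀Ω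
  have hcont : ContinuousWithinAt (fun K => fderiv ℝ (f ∘ r) K (Y K)) (twistorSpace V) K₀ :=
    ((hfr.continuousOn_fderiv_of_isOpen hr.isOpen (by simp)).continuousAt
      hΩ).continuousWithinAt.clm_apply (hY K₀ hK₀)
  have heq : ∀ K ∈ twistorSpace V, K ∈ Ω →
      dTwistor f K (Y K) = fderiv ℝ (f ∘ r) K (Y K) := fun K hK hKΩ =>
    (hr.fderiv_comp_apply hK hKΩ (skewAnti_subset_tangentConeAt hK (hYt K hK))
      (hf.hasFDerivWithinAt hK)).symm
  refine hcont.congr_of_eventuallyEq ?_ (heq K₀ hK₀ hK₀Ω)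
  filter_upwards [self_mem_nhdsWithin, mem_nhdsWithin_of_mem_nhds hΩ] using heq

end TangentialDerivative

section TangentialAlgebra

open Set

variable {V : Type*} [NormedAddCommGroup V] [InnerProductSpace ℝ V] [CompleteSpace V]
  {F f g Y Z : (V →L[ℝ] V) → (V →L[ℝ] V)} {ε : ℝ} {K X θ : V →L[ℝ] V}

theorem dTwistor_id (hK : K ∈ twistorSpace V) (hX : X ∈ skewAnti K) :
    dTwistor (fun K => K) K X = X :=
  dTwistor_eq_of_hasFDerivWithinAt (hasFDerivWithinAt_id K _) hK hX

theorem dTwistor_mul (hf : SmoothOnTwistor f) (hg : SmoothOnTwistor g) (hK : K ∈ twistorSpace V)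
    (hX : X ∈ skewAnti K) :
    dTwistor (fun K => f K * g K) K X = dTwistor f K X * g K + f K * dTwistor g K X := by
  refine (dTwistor_eq_of_hasFDerivWithinAt
    ((hf.hasFDerivWithinAt hK).mul' (hg.hasFDerivWithinAt hK)) hK hX).trans ?_
  simp [dTwistor, add_comm]

theorem dTwistor_add (hf : SmoothOnTwistor f) (hg : SmoothOnTwistor g) (hK : K ∈ twistorSpace V)
    (hX : X ∈ skewAnti K) :
    dTwistor (fun K => f K + g K) K X = dTwistor f K X + dTwistor g K X :=
  dTwistor_eq_of_hasFDerivWithinAt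
    ((hf.hasFDerivWithinAt hK).add (hg.hasFDerivWithinAt hK)) hK hX

theorem dTwistor_sub (hf : SmoothOnTwistor f) (hg : SmoothOnTwistor g) (hK : K ∈ twistorSpace V)
    (hX : X ∈ skewAnti K) :
    dTwistor (fun K => f K - g K) K X = dTwistor f K X - dTwistor g K X :=
  dTwistor_eq_of_hasFDerivWithinAt
    ((hf.hasFDerivWithinAt hK).sub (hg.hasFDerivWithinAt hK)) hK hX

theorem dTwistor_star (hf : SmoothOnTwistor f) (hK : K ∈ twistorSpace V) (hX : X ∈ skewAnti K) :
    dTwistor (fun K => star (f K)) K X = star (dTwistor f K X) :=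
  dTwistor_clm_comp hf ((starL' ℝ : (V →L[ℝ] V) ≃L[ℝ] (V →L[ℝ] V)) : (V →L[ℝ] V) →L[ℝ] (V →L[ℝ] V))
    hK hX

theorem dTwistor_mem_skewEnd (hf : SmoothOnTwistor f) (hfs : ∀ K ∈ twistorSpace V, f K ∈ skewEnd V)
    (hK : K ∈ twistorSpace V) (hX : X ∈ skewAnti K) : dTwistor f K X ∈ skewEnd V := by
  rw [mem_skewEnd_iff, ← dTwistor_star hf hK hX]
  calc dTwistor (fun K => star (f K)) K X = dTwistor (fun K => -f K) K X :=
        dTwistor_congr (fun K hK => mem_skewEnd_iff.1 (hfs K hK)) hK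
    _ = -dTwistor f K X := dTwistor_clm_comp hf (-ContinuousLinearMap.id ℝ _) hK hX

theorem lieBracketWithin_mem_skewAnti (hY : SmoothOnTwistor Y) (hZ : SmoothOnTwistor Z)
    (hYt : ∀ K ∈ twistorSpace V, Y K ∈ skewAnti K) (hZt : ∀ K ∈ twistorSpace V, Z K ∈ skewAnti K)
    (hK : K ∈ twistorSpace V) :
    VectorField.lieBracketWithin ℝ Y Z (twistorSpace V) K ∈ skewAnti K := by
  have hanti : ∀ {Y X}, SmoothOnTwistor Y → (∀ K ∈ twistorSpace V, Y K ∈ skewAnti K) →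
      X ∈ skewAnti K →
      dTwistor Y K X * K + Y K * X = -(X * Y K + K * dTwistor Y K X) := by
    intro Y X hY hYt hX
    have hid : SmoothOnTwistor (fun K : V →L[ℝ] V => K) := contDiffOn_id
    calc dTwistor Y K X * K + Y K * X = dTwistor (fun K => Y K * K) K X := by
          rw [dTwistor_mul hY hid hK hX, dTwistor_id hK hX]
      _ = dTwistor (fun K => -(K * Y K)) K X :=
          dTwistor_congr (fun K hK => (mem_skewAnti_iff.1 (hYt K hK)).2) hK
      _ = -dTwistor (fun K => K * Y K) K X :=
          dTwistor_clm_comp (ContDiffOn.mul hid hY) (-ContinuousLinearMap.id ℝ _) hK hX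
      _ = _ := by rw [dTwistor_mul hid hY hK hX, dTwistor_id hK hX]
  have hYZ := hanti hZ hZt (hYt K hK)
  have hZY := hanti hY hYt (hZt K hK)
  refine mem_skewAnti_iff.2 ⟨mem_skewEnd_iff.1 (sub_mem ?_ ?_), ?_⟩
  · exact dTwistor_mem_skewEnd hZ (fun K hK => (hZt K hK).1) hK (hYt K hK)
  · exact dTwistor_mem_skewEnd hY (fun K hK => (hYt K hK).1) hK (hZt K hK)
  · change (dTwistor Z K (Y K) - dTwistor Y K (Z K)) * K =
      -(K * (dTwistor Z K (Y K) - dTwistor Y K (Z K)))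
    rw [sub_mul, mul_sub, eq_sub_of_add_eq hYZ, eq_sub_of_add_eq hZY]
    abel

theorem dTwistor_sandwich (hF : SmoothOnTwistor F) (hε : ε * ε = 1)
    (hFs : ∀ K ∈ twistorSpace V, star (F K) = ε • F K) (hK : K ∈ twistorSpace V)
    (hX : X ∈ skewAnti K) (hθ : dTwistor F K X = F K * θ) (C : V →L[ℝ] V) :
    dTwistor (fun K => F K * C * F K) K X = F K * (θ * C + C * star θ) * F K := by
  have hC : SmoothOnTwistor (fun _ : V →L[ℝ] V => C) := contDiffOn_const
  let starCLM : (V →L[ℝ] V) →L[ℝ] (V →L[ℝ] V) := (starL' ℝ : (V →L[ℝ] V) ≃L[ℝ] (V →L[ℝ] V))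
  have hθ' : dTwistor F K X = star θ * F K :=
    calc dTwistor F K X = dTwistor (fun K => ε • star (F K)) K X :=
          dTwistor_congr (fun K hK => by simp only [hFs K hK, smul_smul, hε, one_smul]) hK
      _ = ε • star (dTwistor F K X) := dTwistor_clm_comp hF (ε • starCLM) hK hX
      _ = star θ * F K := by
          rw [hθ, star_mul, hFs K hK, mul_smul_comm, smul_smul, hε, one_smul]
  rw [dTwistor_mul (ContDiffOn.mul hF hC) hF hK hX, dTwistor_mul hF hC hK hX, dTwistor_const,
    mul_zero, add_zero]
  nth_rw 1 [hθ]
  rw [hθ']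
  noncomm_ring

theorem dTwistor_skewProj (hf : SmoothOnTwistor f) (hK : K ∈ twistorSpace V)
    (hX : X ∈ skewAnti K) :
    dTwistor (fun K => skewProj 1 K (f K)) K X = skewProj 1 K (dTwistor f K X) +
      (1 / 4 : ℝ) • (X * (f K - star (f K)) * K + K * (f K - star (f K)) * X) := by
  have hid : SmoothOnTwistor (fun K : V →L[ℝ] V => K) := contDiffOn_id
  let δ : (V →L[ℝ] V) →L[ℝ] (V →L[ℝ] V) := ContinuousLinearMap.id ℝ (V →L[ℝ] V) -
    ((starL' ℝ : (V →L[ℝ] V) ≃L[ℝ] (V →L[ℝ] V)) : (V →L[ℝ] V) →L[ℝ] (V →L[ℝ] V))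
  have hδ : SmoothOnTwistor (fun K => δ (f K)) := δ.contDiff.comp_contDiffOn hf
  have hKδK : SmoothOnTwistor (fun K => K * δ (f K) * K) :=
    ContDiffOn.mul (ContDiffOn.mul hid hδ) hid
  calc dTwistor (fun K => skewProj 1 K (f K)) K X
      = dTwistor (fun K => (1 / 4 : ℝ) • (δ (f K) + K * δ (f K) * K)) K X := by
        simp only [skewProj_apply, one_smul]; rfl
    _ = (1 / 4 : ℝ) • (dTwistor (fun K => δ (f K)) K X +
          dTwistor (fun K => K * δ (f K) * K) K X) := by
        rw [← dTwistor_add hδ hKδK hK hX]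
        exact dTwistor_clm_comp (ContDiffOn.add hδ hKδK)
          ((1 / 4 : ℝ) • ContinuousLinearMap.id ℝ (V →L[ℝ] V)) hK hX
    _ = (1 / 4 : ℝ) • (δ (dTwistor f K X) +
          ((X * δ (f K) + K * δ (dTwistor f K X)) * K + K * δ (f K) * X)) := by
        rw [dTwistor_mul (ContDiffOn.mul hid hδ) hid hK hX, dTwistor_mul hid hδ hK hX,
          dTwistor_id hK hX, dTwistor_clm_comp hf δ hK hX]
    _ = skewProj 1 K (dTwistor f K X) +
          (1 / 4 : ℝ) • (X * δ (f K) * K + K * δ (f K) * X) := by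
        rw [skewProj_apply, one_smul, add_mul, ← smul_add]
        congr 1
        change _ = δ (dTwistor f K X) + K * δ (dTwistor f K X) * K + _
        generalize dTwistor f K X = Y
        abel

end TangentialAlgebra

/-! ### Distributions defined by intertwining sections -/

section Intertwiners

open Set

variable {V : Type*} [NormedAddCommGroup V] [InnerProductSpace ℝ V]
  {F k L : (V →L[ℝ] V) → (V →L[ℝ] V)} {ε : ℝ} {J K X θ : V →L[ℝ] V}

theorem mul_mul_self_mem_kerZeroImStable (F C : V →L[ℝ] V) : F * C * F ∈ kerZeroImStable F :=
  ⟨fun v hv => by simp [hv], fun v => ⟨C (F (F v)), rfl⟩⟩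

variable [CompleteSpace V]

/-- A smooth section `F` of self-adjoint (`ε = 1`) or skew-adjoint (`ε = -1`) endomorphisms that
intertwines the sections `k` and `L` in both directions. Conjugation by `F` then carries
endomorphisms (anti)commuting with `L` to endomorphisms (anti)commuting with `k`; this is used for
`k = φ` and for `k = J`. -/
structure IsIntertwiner (F k L : (V →L[ℝ] V) → (V →L[ℝ] V)) (ε : ℝ) : Prop where
  sign : ε * ε = 1
  smooth : SmoothOnTwistor F
  continuousOn : ContinuousOn L (twistorSpace V)
  star_eq : ∀ K ∈ twistorSpace V, star (F K) = ε • F K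
  left_mul : ∀ K ∈ twistorSpace V, k K * F K = F K * L K
  mul_right : ∀ K ∈ twistorSpace V, F K * k K = L K * F K

theorem IsIntertwiner.skewSandwich_eq (h : IsIntertwiner F k L ε) (hK : K ∈ twistorSpace V)
    (τ : ℝ) (C : V →L[ℝ] V) :
    skewSandwich τ (k K) (F K) C = F K * skewProj τ (L K) C * F K := by
  rw [skewSandwich_apply,
    mul_skewProj_mul h.sign (h.star_eq K hK) (h.left_mul K hK) (h.mul_right K hK)]

theorem exists_eq_mul_mul_self_of_ker_le [FiniteDimensional ℝ V] {F B : V →L[ℝ] V}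
    (hF : star F = ε • F) (hB : star B = -B) (hker : ∀ v, F v = 0 → B v = 0) :
    ∃ C, F * C * F = B := by
  obtain ⟨d, s, p, -, hsp⟩ := exists_section_projection F
  let G : V →L[ℝ] V := s ∘L p
  have hright : B * (G * F) = B := by
    ext1 v
    have hv : B (v - G (F v)) = 0 := hker _ (by simp [G, hsp])
    rw [map_sub, sub_eq_zero] at hv
    exact hv.symm
  have hleft : ε • (F * (star G * B)) = B := by
    have h := congrArg star hright
    rwa [star_mul, star_mul, hF, hB, mul_neg, neg_inj, smul_mul_assoc, smul_mul_assoc,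
      mul_assoc] at h
  refine ⟨ε • (star G * B * G), ?_⟩
  calc F * (ε • (star G * B * G)) * F = ε • (F * (star G * B)) * (G * F) := by
        simp only [mul_smul_comm, smul_mul_assoc, mul_assoc]
    _ = B := by rw [hleft, hright]

theorem IsIntertwiner.range_skewSandwich [FiniteDimensional ℝ V] {τ : ℝ}
    {P : Submodule ℝ (V →L[ℝ] V)} (h : IsIntertwiner F k L ε) (hK : K ∈ twistorSpace V)
    (hPskew : P ≤ skewEnd V) (hmem : ∀ C, skewProj τ (k K) C ∈ P)
    (hfix : ∀ B ∈ P, skewProj τ (k K) B = B) :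
    (skewSandwich τ (k K) (F K)).range = P ⊓ kerZeroImStable (F K) := by
  ext B
  constructor
  · rintro ⟨C, rfl⟩
    refine ⟨(skewSandwich_apply τ (k K) (F K) C).symm ▸ hmem _, ?_⟩
    exact (h.skewSandwich_eq hK τ C).symm ▸ mul_mul_self_mem_kerZeroImStable _ _
  · rintro ⟨hB, hker, -⟩
    obtain ⟨C, rfl⟩ := exists_eq_mul_mul_self_of_ker_le (h.star_eq K hK)
      (mem_skewEnd_iff.1 (hPskew hB)) hker
    exact ⟨C, (skewSandwich_apply τ (k K) (F K) C).trans (hfix _ hB)⟩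

theorem IsIntertwiner.range_skewSandwich_one [FiniteDimensional ℝ V]
    (h : IsIntertwiner F (fun K => K) L ε) (hK : K ∈ twistorSpace V) :
    (skewSandwich 1 K (F K)).range = distF F K :=
  h.range_skewSandwich hK (fun _ hB => hB.1) (skewProj_one_mem_skewAnti hK)
    fun _ => (skewProj_one_eq_self_iff hK).2

theorem IsIntertwiner.range_skewSandwich_neg_one [FiniteDimensional ℝ V]
    (hJ : J ∈ twistorSpace V) (h : IsIntertwiner F (fun _ => J) L ε) (hK : K ∈ twistorSpace V) :
    (skewSandwich (-1) J (F K)).range = unitaryAlg J ⊓ kerZeroImStable (F K) :=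
  h.range_skewSandwich hK (fun _ hB => hB.1) (skewProj_neg_one_mem_unitaryAlg hJ)
    fun _ => (skewProj_neg_one_eq_self_iff hJ).2

theorem IsIntertwiner.continuousOn_skewProj (h : IsIntertwiner F k L ε) (τ : ℝ) (C : V →L[ℝ] V) :
    ContinuousOn (fun K => skewProj τ (L K) C) (twistorSpace V) :=
  ((contDiff_skewProj (n := 0)).continuous.comp_continuousOn h.continuousOn).clm_apply
    continuousOn_const

theorem IsIntertwiner.skewProj_dTwistor_skewSandwich
    (h : IsIntertwiner F (fun K => K) L ε) (hK : K ∈ twistorSpace V) (C D : V →L[ℝ] V)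
    (hθ : dTwistor F K (skewSandwich 1 K (F K) C) = F K * θ) :
    skewProj 1 K (dTwistor (fun K => skewSandwich 1 K (F K) D) K (skewSandwich 1 K (F K) C)) =
      skewSandwich 1 K (F K) (θ * D + D * star θ + (1 / 4 : ℝ) •
        (skewProj 1 (L K) C * F K * F K * (D - star D) * L K +
          L K * (D - star D) * F K * F K * skewProj 1 (L K) C)) := by
  obtain ⟨hK2, hKs⟩ := mem_twistorSpace_iff.1 hK
  have hFDF : SmoothOnTwistor (fun K => F K * D * F K) :=
    ContDiffOn.mul (ContDiffOn.mul h.smooth contDiffOn_const) h.smooth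
  have hXt : skewSandwich 1 K (F K) C ∈ skewAnti K :=
    (skewSandwich_apply 1 K (F K) C).symm ▸ skewProj_one_mem_skewAnti hK _
  have hskew : F K * D * F K - star (F K * D * F K) = F K * (D - star D) * F K := by
    rw [← mul_star_mul_self h.sign (h.star_eq K hK), mul_sub, sub_mul]
  have hl : K * F K = F K * L K := h.left_mul K hK
  have hr : F K * K = L K * F K := h.mul_right K hK
  have hd : dTwistor (fun K => skewSandwich 1 K (F K) D) K (skewSandwich 1 K (F K) C) =
      skewProj 1 K (F K * (θ * D + D * star θ) * F K) + (1 / 4 : ℝ) •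
        (skewSandwich 1 K (F K) C * (F K * (D - star D) * F K) * K +
          K * (F K * (D - star D) * F K) * skewSandwich 1 K (F K) C) := by
    simp only [fun K => skewSandwich_apply 1 K (F K) D]
    rw [dTwistor_skewProj hFDF hK hXt, hskew,
      dTwistor_sandwich h.smooth h.sign h.star_eq hK hXt hθ]
  rw [hd, map_add, skewProj_skewProj (one_mul 1) hK2 hKs, ← map_add,
    skewSandwich_apply 1 K _ (_ + _), h.skewSandwich_eq hK]
  generalize skewProj 1 (L K) C = c
  generalize D - star D = d
  congr 1
  calc _ = F K * (θ * D + D * star θ) * F K + (1 / 4 : ℝ) •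
        (F K * c * F K * F K * d * (F K * K) + (K * F K) * d * F K * F K * c * F K) := by
        simp only [mul_assoc]
    _ = _ := by
        rw [hl, hr]
        simp only [mul_add, add_mul, mul_smul_comm, smul_mul_assoc, mul_assoc]

theorem IsIntertwiner.exists_skewProj_dTwistor_skewSandwich
    (h : IsIntertwiner F (fun K => K) L ε) {C : V →L[ℝ] V} (D : V →L[ℝ] V)
    (hθ : ∃ θ : (V →L[ℝ] V) → (V →L[ℝ] V), ContinuousOn θ (twistorSpace V) ∧
      ∀ K ∈ twistorSpace V, dTwistor F K (skewSandwich 1 K (F K) C) = F K * θ K) :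
    ∃ e : (V →L[ℝ] V) → (V →L[ℝ] V), ContinuousOn e (twistorSpace V) ∧ ∀ K ∈ twistorSpace V,
      skewProj 1 K (dTwistor (fun K => skewSandwich 1 K (F K) D) K (skewSandwich 1 K (F K) C)) =
        skewSandwich 1 K (F K) (e K) := by
  obtain ⟨θ, hθ, hdF⟩ := hθ
  have hF := h.smooth.continuousOn
  have hL := h.continuousOn
  have hc := h.continuousOn_skewProj 1 C
  exact ⟨_, by fun_prop, fun K hK => h.skewProj_dTwistor_skewSandwich hK C D (hdF K hK)⟩

theorem IsIntertwiner.exists_dTwistor_skewSandwich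
    (h : IsIntertwiner F (fun _ => J) L ε) {C : V →L[ℝ] V} (D : V →L[ℝ] V)
    (hJ : J ∈ twistorSpace V)
    (hθ : ∃ θ : (V →L[ℝ] V) → (V →L[ℝ] V), ContinuousOn θ (twistorSpace V) ∧
      ∀ K ∈ twistorSpace V, dTwistor F K (commWith K (skewSandwich (-1) J (F K) C)) = F K * θ K) :
    ∃ e : (V →L[ℝ] V) → (V →L[ℝ] V), ContinuousOn e (twistorSpace V) ∧ ∀ K ∈ twistorSpace V,
      dTwistor (fun K => skewSandwich (-1) J (F K) D) K
        (commWith K (skewSandwich (-1) J (F K) C)) = skewSandwich (-1) J (F K) (e K) := by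
  obtain ⟨θ, hθ, hdF⟩ := hθ
  refine ⟨fun K => θ K * D + D * star (θ K), by fun_prop, fun K hK => ?_⟩
  have hX : commWith K (skewSandwich (-1) J (F K) C) ∈ skewAnti K := by
    rw [skewSandwich_apply]
    exact commWith_mem_skewAnti hK (skewProj_neg_one_mem_unitaryAlg hJ _).1
  have hFDF : SmoothOnTwistor (fun K => F K * D * F K) :=
    ContDiffOn.mul (ContDiffOn.mul h.smooth contDiffOn_const) h.smooth
  simp only [fun K => skewSandwich_apply (-1) J (F K) D]
  rw [dTwistor_clm_comp hFDF _ hK hX,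
    dTwistor_sandwich h.smooth h.sign h.star_eq hK hX (hdF K hK), skewSandwich_apply]

theorem IsIntertwiner.exists_commutator_skewSandwich (h : IsIntertwiner F (fun _ => J) L ε)
    (hJ : J ∈ twistorSpace V) (C D : V →L[ℝ] V) :
    ∃ e : (V →L[ℝ] V) → (V →L[ℝ] V), ContinuousOn e (twistorSpace V) ∧ ∀ K ∈ twistorSpace V,
      skewSandwich (-1) J (F K) C * skewSandwich (-1) J (F K) D -
        skewSandwich (-1) J (F K) D * skewSandwich (-1) J (F K) C =
      skewSandwich (-1) J (F K) (e K) := by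
  have hF := h.smooth.continuousOn
  have hc := h.continuousOn_skewProj (-1)
  have hcont : ∀ C D, ContinuousOn
      (fun K => skewProj (-1) (L K) C * F K * F K * skewProj (-1) (L K) D) (twistorSpace V) :=
    fun C D => (((hc C).mul hF).mul hF).mul (hc D)
  refine ⟨fun K => _ - _, (hcont C D).sub (hcont D C), fun K hK => ?_⟩
  have hmem : ∀ C, skewSandwich (-1) J (F K) C ∈ unitaryAlg J := fun C =>
    (skewSandwich_apply (-1) J (F K) C).symm ▸ skewProj_neg_one_mem_unitaryAlg hJ _
  rw [← (skewProj_neg_one_eq_self_iff hJ).2 (commutator_mem_unitaryAlg (hmem C) (hmem D)),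
    skewSandwich_apply _ _ _ (_ - _), h.skewSandwich_eq hK, h.skewSandwich_eq hK]
  congr 1
  noncomm_ring

theorem lieBracketWithin_commWith {Y Z : (V →L[ℝ] V) → (V →L[ℝ] V)}
    (hY : SmoothOnTwistor Y) (hZ : SmoothOnTwistor Z) (hYs : ∀ K ∈ twistorSpace V, Y K ∈ skewEnd V)
    (hZs : ∀ K ∈ twistorSpace V, Z K ∈ skewEnd V) (hK : K ∈ twistorSpace V) :
    VectorField.lieBracketWithin ℝ (fun K => commWith K (Y K)) (fun K => commWith K (Z K))
        (twistorSpace V) K =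
      commWith K (dTwistor Z K (commWith K (Y K)) - dTwistor Y K (commWith K (Z K)) -
        (Y K * Z K - Z K * Y K)) := by
  have hd : ∀ {Z X}, SmoothOnTwistor Z → X ∈ skewAnti K →
      dTwistor (fun K => commWith K (Z K)) K X =
        dTwistor Z K X * K + Z K * X - (X * Z K + K * dTwistor Z K X) := by
    intro Z X hZ hX
    have hid : SmoothOnTwistor (fun K : V →L[ℝ] V => K) := contDiffOn_id
    change dTwistor (fun K => Z K * K - K * Z K) K X = _
    rw [dTwistor_sub (ContDiffOn.mul hZ hid) (ContDiffOn.mul hid hZ) hK hX,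
      dTwistor_mul hZ hid hK hX, dTwistor_mul hid hZ hK hX, dTwistor_id hK hX]
  change dTwistor (fun K => commWith K (Z K)) K (commWith K (Y K)) -
    dTwistor (fun K => commWith K (Y K)) K (commWith K (Z K)) = _
  rw [hd hZ (commWith_mem_skewAnti hK (hYs K hK)), hd hY (commWith_mem_skewAnti hK (hZs K hK))]
  simp only [commWith, LinearMap.coe_mk, AddHom.coe_mk]
  noncomm_ring

end Intertwiners

section Integrability

open Set

variable {V : Type*} [NormedAddCommGroup V] [InnerProductSpace ℝ V] [CompleteSpace V]
  [FiniteDimensional ℝ V] {F L : (V →L[ℝ] V) → (V →L[ℝ] V)} {ε : ℝ} {J : V →L[ℝ] V}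

theorem isIntegrableDistribution_distF (h : IsIntertwiner F (fun K => K) L ε)
    (hθ : ∀ C, ∃ θ : (V →L[ℝ] V) → (V →L[ℝ] V), ContinuousOn θ (twistorSpace V) ∧
      ∀ K ∈ twistorSpace V, dTwistor F K (skewSandwich 1 K (F K) C) = F K * θ K) :
    IsIntegrableDistribution (twistorSpace V) (distF F) := by
  have hρ : SmoothOnTwistor (fun K => skewSandwich 1 K (F K)) :=
    contDiffOn_skewSandwich contDiffOn_id h.smooth
  have htan : ∀ K ∈ twistorSpace V, ∀ C, skewSandwich 1 K (F K) C ∈ skewAnti K := fun K hK C =>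
    (skewSandwich_apply 1 K (F K) C).symm ▸ skewProj_one_mem_skewAnti hK _
  refine isIntegrableDistribution_of_involutive isLocalSmoothRetract_twistorSpace hρ
    (fun K hK => h.range_skewSandwich_one hK)
    (fun K hK C => skewAnti_subset_tangentConeAt hK (htan K hK C)) fun C D => ?_
  have hX : ∀ C, SmoothOnTwistor (fun K => skewSandwich 1 K (F K) C) := fun C =>
    ContDiffOn.clm_apply hρ contDiffOn_const
  obtain ⟨e, he, heq⟩ := h.exists_skewProj_dTwistor_skewSandwich D (hθ C)
  obtain ⟨e', he', heq'⟩ := h.exists_skewProj_dTwistor_skewSandwich C (hθ D)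
  refine ⟨fun K => e K - e' K, he.sub he', fun K hK => ?_⟩
  rw [← (skewProj_one_eq_self_iff hK).2
    (lieBracketWithin_mem_skewAnti (hX C) (hX D) (htan · · C) (htan · · D) hK)]
  change skewProj 1 K (dTwistor _ K _ - dTwistor _ K _) = _
  rw [map_sub, heq K hK, heq' K hK, map_sub]

theorem isIntegrableDistribution_distU (hJ : J ∈ twistorSpace V)
    (h : IsIntertwiner F (fun _ => J) L ε)
    (hθ : ∀ C, ∃ θ : (V →L[ℝ] V) → (V →L[ℝ] V), ContinuousOn θ (twistorSpace V) ∧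
      ∀ K ∈ twistorSpace V, dTwistor F K (commWith K (skewSandwich (-1) J (F K) C)) = F K * θ K) :
    IsIntegrableDistribution (twistorSpace V) (distU J F) := by
  let comm (K : V →L[ℝ] V) : (V →L[ℝ] V) →L[ℝ] (V →L[ℝ] V) :=
    (ContinuousLinearMap.mul ℝ (V →L[ℝ] V)).flip K - ContinuousLinearMap.mul ℝ (V →L[ℝ] V) K
  have hcomm : ContDiff ℝ ∞ comm :=
    (ContinuousLinearMap.contDiff _).sub (ContinuousLinearMap.contDiff _)
  have hβ : SmoothOnTwistor (fun K => skewSandwich (-1) J (F K)) :=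
    contDiffOn_skewSandwich contDiffOn_const h.smooth
  have hρ : SmoothOnTwistor (fun K => comm K ∘L skewSandwich (-1) J (F K)) :=
    ContDiffOn.clm_comp hcomm.contDiffOn hβ
  have hβJ : ∀ K C, skewSandwich (-1) J (F K) C ∈ unitaryAlg J := fun K C =>
    (skewSandwich_apply (-1) J (F K) C).symm ▸ skewProj_neg_one_mem_unitaryAlg hJ _
  refine isIntegrableDistribution_of_involutive isLocalSmoothRetract_twistorSpace hρ
    (fun K hK => ?_) (fun K hK C => skewAnti_subset_tangentConeAt hK
      (commWith_mem_skewAnti hK (hβJ K C).1)) fun C D => ?_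
  · rw [distU, ← h.range_skewSandwich_neg_one hJ hK]
    exact LinearMap.range_comp _ _
  have hX : ∀ C, SmoothOnTwistor (fun K => skewSandwich (-1) J (F K) C) := fun C =>
    ContDiffOn.clm_apply hβ contDiffOn_const
  obtain ⟨e, he, heq⟩ := h.exists_dTwistor_skewSandwich D hJ (hθ C)
  obtain ⟨e', he', heq'⟩ := h.exists_dTwistor_skewSandwich C hJ (hθ D)
  obtain ⟨e'', he'', heq''⟩ := h.exists_commutator_skewSandwich hJ C D
  refine ⟨fun K => e K - e' K - e'' K, (he.sub he').sub he'', fun K hK => ?_⟩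
  change VectorField.lieBracketWithin ℝ
    (fun K => commWith K (skewSandwich (-1) J (F K) C))
    (fun K => commWith K (skewSandwich (-1) J (F K) D)) (twistorSpace V) K =
      commWith K (skewSandwich (-1) J (F K) (e K - e' K - e'' K))
  rw [lieBracketWithin_commWith (hX C) (hX D) (fun K _ => (hβJ K C).1) (fun K _ => (hβJ K D).1)
    hK, heq K hK, heq' K hK, heq'' K hK]
  simp only [map_sub]

end Integrability

/-! ### The four basic sections -/

section BasicSections

theorem mul_commutator_of_mul_self_eq_neg_one {R : Type*} [Ring R] {a : R} (ha : a * a = -1)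
    (b : R) : a * (a * b - b * a) = (a * b - b * a) * -a := by
  rw [mul_sub, ← mul_assoc a a, ha, mul_neg, sub_mul, mul_assoc b, ha]
  noncomm_ring

theorem commutator_mul_of_mul_self_eq_neg_one {R : Type*} [Ring R] {a : R} (ha : a * a = -1)
    (b : R) : (a * b - b * a) * a = -a * (a * b - b * a) := by
  rw [neg_mul, mul_commutator_of_mul_self_eq_neg_one ha, mul_neg, neg_neg]

variable {V : Type*} [NormedAddCommGroup V] [InnerProductSpace ℝ V]
  {S L N Q : (V →L[ℝ] V) → (V →L[ℝ] V)} {σ κ : (V →L[ℝ] V) →L[ℝ] (V →L[ℝ] V)} {ε : ℝ}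
  {J K c q B : V →L[ℝ] V}

theorem commWith_mul_mul {F L C : V →L[ℝ] V} (hl : K * F = F * L) (hr : F * K = L * F) :
    commWith K (F * C * F) = F * commWith L C * F := by
  change F * C * F * K - K * (F * C * F) = F * (C * L - L * C) * F
  rw [mul_assoc _ F K, hr, mul_assoc F C F, ← mul_assoc K F, hl]
  noncomm_ring

variable [CompleteSpace V]

/-- The common structure of the sections `1`, `J + φ`, `J - φ` and `[J, φ]`: `S` intertwines `φ`
with `L` and `J` with `N`, and its derivative is a constant map `σ` such that `σ ∘ Ad = Ad ∘ κ`
for the sandwich map `Ad C = S * C * S`. -/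
structure IsBasicSection (J : V →L[ℝ] V) (S L N : (V →L[ℝ] V) → (V →L[ℝ] V))
    (σ κ : (V →L[ℝ] V) →L[ℝ] (V →L[ℝ] V)) (ε : ℝ) : Prop where
  intertwiner_phi : IsIntertwiner S (fun K => K) L ε
  intertwiner_J : IsIntertwiner S (fun _ => J) N ε
  hasFDerivAt : ∀ K, HasFDerivAt S σ K
  commute : ∀ {K q}, Commute q J → Commute q K →
    Commute q (S K) ∧ Commute q (L K) ∧ Commute q (N K)
  map_mul_mul : ∀ {q}, Commute q J → ∀ Y, σ (q * Y * q) = q * σ Y * q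
  map_sandwich : ∀ K ∈ twistorSpace V, ∀ C, σ (S K * C * S K) = S K * κ C * S K

theorem isBasicSection_one (J : V →L[ℝ] V) :
    IsBasicSection J (fun _ => 1) (fun K => K) (fun _ => J) 0 0 1 where
  intertwiner_phi := ⟨one_mul 1, contDiffOn_const, continuousOn_id, by simp, by simp, by simp⟩
  intertwiner_J := ⟨one_mul 1, contDiffOn_const, continuousOn_const, by simp, by simp, by simp⟩
  hasFDerivAt _ := hasFDerivAt_const _ _
  commute hJ hK := ⟨.one_right _, hK, hJ⟩
  map_mul_mul := by simp
  map_sandwich := by simp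

theorem isBasicSection_add_smul (hJ : J ∈ twistorSpace V) {τ : ℝ} (hτ : τ * τ = 1) :
    IsBasicSection J (fun K => J + τ • K) (fun _ => τ • J) (fun K => τ • K)
      (τ • .id ℝ _) (τ • .id ℝ _) (-1) := by
  obtain ⟨hJ2, hJs⟩ := mem_twistorSpace_iff.1 hJ
  have hS : SmoothOnTwistor (fun K => J + τ • K) := ContDiff.contDiffOn (by fun_prop)
  have hstar : ∀ K ∈ twistorSpace V, star (J + τ • K) = (-1 : ℝ) • (J + τ • K) := fun K hK => by
    rw [star_add, star_smul, hJs, (mem_twistorSpace_iff.1 hK).2, star_trivial]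
    module
  have hmul : ∀ K ∈ twistorSpace V, K * (J + τ • K) = (J + τ • K) * τ • J ∧
      (J + τ • K) * K = τ • J * (J + τ • K) ∧ J * (J + τ • K) = (J + τ • K) * τ • K ∧
      (J + τ • K) * J = τ • K * (J + τ • K) := fun K hK => by
    simp only [mul_add, add_mul, smul_add, mul_smul_comm, smul_mul_assoc, smul_smul, hτ, hJ2,
      (mem_twistorSpace_iff.1 hK).1, one_smul]
    exact ⟨add_comm _ _, add_comm _ _, add_comm _ _, add_comm _ _⟩
  exact
  { intertwiner_phi := ⟨by norm_num, hS, continuousOn_const, hstar, fun K hK => (hmul K hK).1,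
      fun K hK => (hmul K hK).2.1⟩
    intertwiner_J := ⟨by norm_num, hS, continuousOn_id.const_smul τ, hstar,
      fun K hK => (hmul K hK).2.2.1, fun K hK => (hmul K hK).2.2.2⟩
    hasFDerivAt K := ((hasFDerivAt_id K).const_smul τ).const_add J
    commute hqJ hqK := ⟨hqJ.add_right (hqK.smul_right τ), hqJ.smul_right τ, hqK.smul_right τ⟩
    map_mul_mul := by simp
    map_sandwich := by simp }

theorem isBasicSection_commutator (hJ : J ∈ twistorSpace V) :
    IsBasicSection J (fun K => J * K - K * J) (fun K => -K) (fun _ => -J)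
      (.mul ℝ (V →L[ℝ] V) J - (ContinuousLinearMap.mul ℝ (V →L[ℝ] V)).flip J)
      (-(.mul ℝ (V →L[ℝ] V) J - (ContinuousLinearMap.mul ℝ (V →L[ℝ] V)).flip J)) (-1) := by
  obtain ⟨hJ2, hJs⟩ := mem_twistorSpace_iff.1 hJ
  have hS : SmoothOnTwistor (fun K => J * K - K * J) :=
    ((contDiff_const.mul contDiff_id).sub (contDiff_id.mul contDiff_const)).contDiffOn
  have hstar : ∀ K ∈ twistorSpace V, star (J * K - K * J) = (-1 : ℝ) • (J * K - K * J) :=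
    fun K hK => by
      rw [star_sub, star_mul, star_mul, hJs, (mem_twistorSpace_iff.1 hK).2]
      simp
  have hmul : ∀ K ∈ twistorSpace V, K * (J * K - K * J) = (J * K - K * J) * -K ∧
      (J * K - K * J) * K = -K * (J * K - K * J) := fun K hK => by
    have hK2 := (mem_twistorSpace_iff.1 hK).1
    rw [← neg_sub, mul_neg, mul_commutator_of_mul_self_eq_neg_one hK2,
      neg_mul _ K, commutator_mul_of_mul_self_eq_neg_one hK2]
    simp only [neg_mul, mul_neg, and_self]
  have hl := mul_commutator_of_mul_self_eq_neg_one hJ2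
  have hr := commutator_mul_of_mul_self_eq_neg_one hJ2
  exact
  { intertwiner_phi := ⟨by norm_num, hS, continuousOn_id.neg, hstar, fun K hK => (hmul K hK).1,
      fun K hK => (hmul K hK).2⟩
    intertwiner_J := ⟨by norm_num, hS, continuousOn_const, hstar, fun K _ => hl K,
      fun K _ => hr K⟩
    hasFDerivAt K := ContinuousLinearMap.hasFDerivAt (.mul ℝ (V →L[ℝ] V) J -
      (ContinuousLinearMap.mul ℝ (V →L[ℝ] V)).flip J)
    commute hqJ hqK :=
      ⟨(hqJ.mul_right hqK).sub_right (hqK.mul_right hqJ), hqK.neg_right, hqJ.neg_right⟩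
    map_mul_mul {q} hq Y := by
      change J * (q * Y * q) - q * Y * q * J = q * (J * Y - Y * J) * q
      calc _ = J * q * Y * q - q * Y * (q * J) := by noncomm_ring
        _ = q * J * Y * q - q * Y * (J * q) := by rw [hq.eq]
        _ = _ := by noncomm_ring
    map_sandwich K _ C := by
      change J * (_ * C * _) - _ * C * _ * J = _ * -(J * C - C * J) * _
      calc _ = J * (J * K - K * J) * C * (J * K - K * J) -
            (J * K - K * J) * C * ((J * K - K * J) * J) := by simp only [mul_assoc]
        _ = _ := by rw [hl, hr]; noncomm_ring }

theorem exists_isBasicSection (hJ : J ∈ twistorSpace V) (hS : S ∈ basicSections J) :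
    ∃ L N σ κ ε, IsBasicSection J S L N σ κ ε := by
  rcases hS with rfl | rfl | rfl | rfl
  · exact ⟨_, _, _, _, _, isBasicSection_one J⟩
  · exact ⟨_, _, _, _, _, by simpa using isBasicSection_add_smul hJ (one_mul 1)⟩
  · exact ⟨_, _, _, _, _, by
      simpa [← sub_eq_add_neg] using isBasicSection_add_smul hJ (τ := -1) (by norm_num)⟩
  · exact ⟨_, _, _, _, _, isBasicSection_commutator hJ⟩

theorem IsAdmissible.star_eq (hQ : IsAdmissible J Q) (hK : K ∈ twistorSpace V) :
    star (Q K) = Q K := by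
  rw [ContinuousLinearMap.star_eq_adjoint, eq_comm, ContinuousLinearMap.eq_adjoint_iff]
  exact hQ.selfAdjoint K hK

theorem IsIntertwiner.mul_left {k : (V →L[ℝ] V) → (V →L[ℝ] V)} (h : IsIntertwiner S k L ε)
    (hQ : SmoothOnTwistor Q) (hQs : ∀ K ∈ twistorSpace V, star (Q K) = Q K)
    (hk : ∀ K ∈ twistorSpace V, Commute (Q K) (k K))
    (hS : ∀ K ∈ twistorSpace V, Commute (Q K) (S K))
    (hL : ∀ K ∈ twistorSpace V, Commute (Q K) (L K)) :
    IsIntertwiner (fun K => Q K * S K) k L ε where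
  sign := h.sign
  smooth := ContDiffOn.mul hQ h.smooth
  continuousOn := h.continuousOn
  star_eq K hK := by
    rw [star_mul, hQs K hK, h.star_eq K hK, smul_mul_assoc, (hS K hK).eq]
  left_mul K hK := by
    rw [← mul_assoc, ← (hk K hK).eq, mul_assoc, h.left_mul K hK, mul_assoc]
  mul_right K hK := by
    rw [mul_assoc, h.mul_right K hK, ← mul_assoc, (hL K hK).eq, mul_assoc]

theorem IsBasicSection.commute_of_isAdmissible (h : IsBasicSection J S L N σ κ ε)
    (hQ : IsAdmissible J Q) (hK : K ∈ twistorSpace V) :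
    Commute (Q K) (S K) ∧ Commute (Q K) (L K) ∧ Commute (Q K) (N K) :=
  h.commute (hQ.comm_J K hK) (hQ.comm_phi K hK)

theorem IsBasicSection.isIntertwiner_mul_phi (h : IsBasicSection J S L N σ κ ε)
    (hQ : IsAdmissible J Q) : IsIntertwiner (fun K => Q K * S K) (fun K => K) L ε :=
  h.intertwiner_phi.mul_left hQ.smooth (fun _ hK => hQ.star_eq hK) hQ.comm_phi
    (fun _ hK => (h.commute_of_isAdmissible hQ hK).1)
    fun _ hK => (h.commute_of_isAdmissible hQ hK).2.1

theorem IsBasicSection.isIntertwiner_mul_J (h : IsBasicSection J S L N σ κ ε)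
    (hQ : IsAdmissible J Q) : IsIntertwiner (fun K => Q K * S K) (fun _ => J) N ε :=
  h.intertwiner_J.mul_left hQ.smooth (fun _ hK => hQ.star_eq hK) hQ.comm_J
    (fun _ hK => (h.commute_of_isAdmissible hQ hK).1)
    fun _ hK => (h.commute_of_isAdmissible hQ hK).2.2

theorem mul_mul_mem_skewAnti (hq : star q = q) (hqK : Commute q K) (hB : B ∈ skewAnti K) :
    q * B * q ∈ skewAnti K := by
  obtain ⟨hBs, hBK⟩ := mem_skewAnti_iff.1 hB
  refine mem_skewAnti_iff.2 ⟨?_, ?_⟩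
  · rw [star_mul, star_mul, hq, hBs, neg_mul, mul_neg, mul_assoc]
  · rw [mul_assoc, hqK.eq, ← mul_assoc, mul_assoc q B K, hBK, mul_neg, ← mul_assoc q K, hqK.eq]
    noncomm_ring

theorem IsBasicSection.dTwistor_mul_eq (h : IsBasicSection J S L N σ κ ε) (hQ : IsAdmissible J Q)
    (hK : K ∈ twistorSpace V) (hY : S K * c * S K ∈ skewAnti K)
    (hQY : dTwistor Q K (Q K * (S K * c * S K) * Q K) =
      Q K * dTwistor Q K (S K * c * S K) * Q K) :
    dTwistor (fun K => Q K * S K) K (Q K * S K * c * (Q K * S K)) =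
      Q K * S K * (dTwistor Q K (S K * c * S K) * Q K + κ c * S K * (Q K * Q K)) := by
  have hS : SmoothOnTwistor S := h.intertwiner_phi.smooth
  have hdS : ∀ {X}, X ∈ skewAnti K → dTwistor S K X = σ X := fun hX =>
    dTwistor_eq_of_hasFDerivWithinAt (h.hasFDerivAt K).hasFDerivWithinAt hK hX
  have hqS := (h.commute_of_isAdmissible hQ hK).1.eq
  have hX := mul_mul_mem_skewAnti (hQ.star_eq hK) (hQ.comm_phi K hK) hY
  have hFcF : Q K * S K * c * (Q K * S K) = Q K * (S K * c * S K) * Q K := by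
    rw [hqS]
    nth_rw 1 [← hqS]
    simp only [mul_assoc]
  have hdcomm : dTwistor Q K (S K * c * S K) * S K + Q K * σ (S K * c * S K) =
      σ (S K * c * S K) * Q K + S K * dTwistor Q K (S K * c * S K) := by
    rw [← hdS hY, ← dTwistor_mul hQ.smooth hS hK hY, ← dTwistor_mul hS hQ.smooth hK hY,
      dTwistor_congr (fun _ hK => (h.commute_of_isAdmissible hQ hK).1.eq) hK]
  rw [hFcF, dTwistor_mul hQ.smooth hS hK hX, hdS hX, hQY, h.map_mul_mul (hQ.comm_J K hK)]
  generalize dTwistor Q K (S K * c * S K) = δ at hdcomm ⊢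
  calc Q K * δ * Q K * S K + Q K * (Q K * σ (S K * c * S K) * Q K)
      = Q K * (δ * S K + Q K * σ (S K * c * S K)) * Q K := by
        rw [mul_assoc _ (Q K) (S K), hqS]; noncomm_ring
    _ = Q K * S K * (δ * Q K + κ c * S K * (Q K * Q K)) := by
        rw [hdcomm, h.map_sandwich K hK]; noncomm_ring

theorem IsBasicSection.exists_dTwistor_mul_eq (h : IsBasicSection J S L N σ κ ε)
    (hQ : IsAdmissible J Q) {D : (V →L[ℝ] V) → Submodule ℝ (V →L[ℝ] V)}
    (hD : ∀ K ∈ twistorSpace V, D K ≤ skewAnti K) (hQD : QCondition Q D)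
    {c : (V →L[ℝ] V) → (V →L[ℝ] V)} (hc : ContinuousOn c (twistorSpace V))
    (hcD : ∀ K ∈ twistorSpace V, S K * c K * S K ∈ D K) :
    ∃ θ : (V →L[ℝ] V) → (V →L[ℝ] V), ContinuousOn θ (twistorSpace V) ∧
      ∀ K ∈ twistorSpace V, dTwistor (fun K => Q K * S K) K (Q K * S K * c K * (Q K * S K)) =
        Q K * S K * θ K := by
  have hS := h.intertwiner_phi.smooth.continuousOn
  have hQc := hQ.smooth.continuousOn
  have hY : ∀ K ∈ twistorSpace V, S K * c K * S K ∈ skewAnti K := fun K hK => hD K hK (hcD K hK)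
  have hdQ := hQ.smooth.continuousOn_dTwistor ((hS.mul hc).mul hS) hY
  exact ⟨_, (hdQ.mul hQc).add (((κ.continuous.comp_continuousOn hc).mul hS).mul (hQc.mul hQc)),
    fun K hK => h.dTwistor_mul_eq hQ hK (hY K hK) (hQD K hK _ (hcD K hK))⟩

theorem distU_le_skewAnti (F : (V →L[ℝ] V) → (V →L[ℝ] V)) (hK : K ∈ twistorSpace V) :
    distU J F K ≤ skewAnti K := by
  rintro _ ⟨B, hB, rfl⟩
  exact commWith_mem_skewAnti hK hB.1.1

theorem IsBasicSection.isIntegrableDistribution_distF [FiniteDimensional ℝ V]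
    (h : IsBasicSection J S L N σ κ ε) (hQ : IsAdmissible J Q) (hQD : QCondition Q (distF S)) :
    IsIntegrableDistribution (twistorSpace V) (distF (fun K => Q K * S K)) := by
  have hF := h.isIntertwiner_mul_phi hQ
  refine _root_.isIntegrableDistribution_distF hF fun C => ?_
  have hcD : ∀ K ∈ twistorSpace V, S K * skewProj 1 (L K) C * S K ∈ distF S K := fun K hK => by
    rw [← h.intertwiner_phi.skewSandwich_eq hK, ← h.intertwiner_phi.range_skewSandwich_one hK]
    exact ⟨C, rfl⟩
  obtain ⟨θ, hθ, hdF⟩ := h.exists_dTwistor_mul_eq hQ (fun _ _ => inf_le_left) hQD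
    (hF.continuousOn_skewProj 1 C) hcD
  exact ⟨θ, hθ, fun K hK => (congrArg _ (hF.skewSandwich_eq hK 1 C)).trans (hdF K hK)⟩

theorem IsBasicSection.isIntegrableDistribution_distU [FiniteDimensional ℝ V]
    (hJ : J ∈ twistorSpace V) (h : IsBasicSection J S L N σ κ ε) (hQ : IsAdmissible J Q)
    (hQD : QCondition Q (distU J S)) :
    IsIntegrableDistribution (twistorSpace V) (distU J (fun K => Q K * S K)) := by
  have hF := h.isIntertwiner_mul_J hQ
  refine _root_.isIntegrableDistribution_distU hJ hF fun C => ?_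
  have hcomm : ∀ {G}, IsIntertwiner G (fun K => K) L ε → IsIntertwiner G (fun _ => J) N ε →
      ∀ K ∈ twistorSpace V, commWith K (skewSandwich (-1) J (G K) C) =
        G K * commWith (L K) (skewProj (-1) (N K) C) * G K := fun hφ hJ K hK => by
    rw [hJ.skewSandwich_eq hK, commWith_mul_mul (hφ.left_mul K hK) (hφ.mul_right K hK)]
  have hc : ContinuousOn (fun K => commWith (L K) (skewProj (-1) (N K) C)) (twistorSpace V) := by
    have hL := h.intertwiner_phi.continuousOn
    have hN := hF.continuousOn_skewProj (-1) C
    exact (hN.mul hL).sub (hL.mul hN)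
  obtain ⟨θ, hθ, hdF⟩ := h.exists_dTwistor_mul_eq hQ (fun _ hK => distU_le_skewAnti S hK) hQD hc
    fun K hK => by
      rw [← hcomm h.intertwiner_phi h.intertwiner_J K hK, distU,
        ← h.intertwiner_J.range_skewSandwich_neg_one hJ hK]
      exact ⟨_, ⟨C, rfl⟩, rfl⟩
  exact ⟨θ, hθ, fun K hK =>
    (congrArg _ (hcomm (h.isIntertwiner_mul_phi hQ) hF K hK)).trans (hdF K hK)⟩

end BasicSections

/-! ### Polynomial sections -/

section PolynomialSections

variable {V : Type*} [NormedAddCommGroup V] [InnerProductSpace ℝ V]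
  {S L N : (V →L[ℝ] V) → (V →L[ℝ] V)} {σ κ : (V →L[ℝ] V) →L[ℝ] (V →L[ℝ] V)} {ε : ℝ}
  {D : (V →L[ℝ] V) → Submodule ℝ (V →L[ℝ] V)} {J K B q : V →L[ℝ] V}

theorem isAdmissible_one (J : V →L[ℝ] V) : IsAdmissible J (fun _ => 1) :=
  ⟨contDiffOn_const, fun _ _ _ _ => rfl, fun _ _ => by simp, fun _ _ => by simp⟩

theorem qCondition_one (D : (V →L[ℝ] V) → Submodule ℝ (V →L[ℝ] V)) :
    QCondition (fun _ => 1) D := fun _ _ _ _ => by simp [dTwistor_const]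

theorem ConstantAlongLeaves.annihilatedAlong {a : (V →L[ℝ] V) → ℝ}
    (hc : ConstantAlongLeaves (twistorSpace V) D a) (ha : SmoothOnTwistor a)
    (hD : IsIntegrableDistribution (twistorSpace V) D) : AnnihilatedAlong a D := by
  intro K hK B hB
  obtain ⟨d, U, f, hf, u, hu, rfl⟩ := hD.2 K hK
  rw [← hf.tangent u hu] at hB
  obtain ⟨w, rfl⟩ := hB
  have hU := hf.isOpen.mem_nhds hu
  have hdf : HasFDerivAt f (fderiv ℝ f u) u :=
    ((hf.contDiffOn.contDiffAt hU).differentiableAt (by simp)).hasFDerivAt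
  have hdaf : HasFDerivAt (a ∘ f)
      (fderivWithin ℝ a (twistorSpace V) (f u) ∘L fderiv ℝ f u) u :=
    ((ha.hasFDerivWithinAt hK).comp u hdf.hasFDerivWithinAt hf.mapsTo).hasFDerivAt hU
  have hconst : HasFDerivAt (a ∘ f) (0 : EuclideanSpace ℝ (Fin d) →L[ℝ] ℝ) u := by
    refine (hasFDerivAt_const (a (f u)) u).congr_of_eventuallyEq ?_
    filter_upwards [hU] with v hv
    exact hc _ hK _ (.rel _ _ ⟨d, U, f, hf, ⟨u, hu, rfl⟩, ⟨v, hv, rfl⟩⟩)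
  exact DFunLike.congr_fun (hdaf.unique hconst) w

theorem commute_anticommutator_left {R : Type*} [Ring R] {a : R} (ha : a * a = -1) (b : R) :
    Commute (a * b + b * a) a := by
  change _ * a = a * _
  rw [add_mul, mul_add, mul_assoc b, ← mul_assoc a a, ha, mul_assoc a b, mul_neg_one, neg_one_mul,
    add_comm]

theorem antiComm_comm (A B : V →L[ℝ] V) : antiComm A B = antiComm B A :=
  add_comm _ _

theorem polyQ_commute {k : ℕ} (a : Fin (k + 1) → (V →L[ℝ] V) → ℝ)
    (hq : Commute (antiComm J K) q) : Commute (polyQ J a K) q :=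
  Commute.sum_left _ _ _ fun i _ => (hq.pow_left i).smul_left (a i K)

theorem exists_hasFDerivAt_antiComm_pow (J K : V →L[ℝ] V) (n : ℕ) :
    ∃ p : (V →L[ℝ] V) →L[ℝ] (V →L[ℝ] V), HasFDerivAt (fun K => antiComm J K ^ n) p K ∧
      ∀ q B, Commute q J → Commute q (antiComm J K) → p (q * B * q) = q * p B * q := by
  induction n with
  | zero => exact ⟨0, by simpa using hasFDerivAt_const _ _, by simp⟩
  | succ n ih =>
    obtain ⟨p, hp, hpq⟩ := ih
    let A : (V →L[ℝ] V) →L[ℝ] (V →L[ℝ] V) :=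
      .mul ℝ (V →L[ℝ] V) J + (ContinuousLinearMap.mul ℝ (V →L[ℝ] V)).flip J
    have hA : HasFDerivAt (antiComm J) A K := A.hasFDerivAt
    refine ⟨_, (hp.mul' hA).congr_of_eventuallyEq (.of_forall fun K => pow_succ _ n),
      fun q B hJ hq => ?_⟩
    have hAq : A (q * B * q) = q * A B * q := by
      change J * (q * B * q) + q * B * q * J = q * (J * B + B * J) * q
      calc _ = J * q * B * q + q * B * (q * J) := by noncomm_ring
        _ = q * J * B * q + q * B * (J * q) := by rw [hJ.eq]
        _ = _ := by noncomm_ring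
    change antiComm J K ^ n * A (q * B * q) + p (q * B * q) * antiComm J K =
      q * (antiComm J K ^ n * A B + p B * antiComm J K) * q
    rw [hpq q B hJ hq, hAq]
    calc _ = (antiComm J K ^ n * q) * A B * q + q * p B * (q * antiComm J K) := by noncomm_ring
      _ = _ := by rw [← (hq.pow_right n).eq, hq.eq]; noncomm_ring

theorem mul_mul_mem_kerZeroImStable {F : V →L[ℝ] V} (hq : Commute q F)
    (hB : B ∈ kerZeroImStable F) : q * B * q ∈ kerZeroImStable F := by
  have hqF : ∀ v, q (F v) = F (q v) := DFunLike.congr_fun hq.eq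
  refine ⟨fun v hv => ?_, fun v => ?_⟩
  · have hBq : B (q v) = 0 := hB.1 _ (by rw [← hqF, hv, map_zero])
    simp [hBq]
  · obtain ⟨w, hw⟩ := hB.2 (q v)
    exact ⟨q w, by simp [hqF, hw]⟩

variable [CompleteSpace V]

theorem isAdmissible_polyQ (hJ : J ∈ twistorSpace V) {k : ℕ}
    {a : Fin (k + 1) → (V →L[ℝ] V) → ℝ} (ha : ∀ i, SmoothOnTwistor (a i)) :
    IsAdmissible J (polyQ J a) where
  smooth := ContDiffOn.sum fun i _ => (ha i).smul
    (((contDiff_const.mul contDiff_id).add (contDiff_id.mul contDiff_const)).pow i).contDiffOn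
  selfAdjoint K hK := by
    have hanti : star (antiComm J K) = antiComm J K := by
      rw [antiComm, star_add, star_mul, star_mul, (mem_twistorSpace_iff.1 hJ).2,
        (mem_twistorSpace_iff.1 hK).2, neg_mul_neg, neg_mul_neg, add_comm]
    have hpoly : star (polyQ J a K) = polyQ J a K := by
      simp only [polyQ, star_sum, star_smul, star_pow, hanti, star_trivial]
    rwa [ContinuousLinearMap.star_eq_adjoint, eq_comm, ContinuousLinearMap.eq_adjoint_iff] at hpoly
  comm_J K _ := polyQ_commute a (commute_anticommutator_left (mem_twistorSpace_iff.1 hJ).1 K)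
  comm_phi K hK := polyQ_commute a
    (antiComm_comm K J ▸ commute_anticommutator_left (mem_twistorSpace_iff.1 hK).1 J)

theorem qCondition_polyQ (hJ : J ∈ twistorSpace V) {k : ℕ} {a : Fin (k + 1) → (V →L[ℝ] V) → ℝ}
    (ha : ∀ i, SmoothOnTwistor (a i)) (hD : ∀ K ∈ twistorSpace V, D K ≤ skewAnti K)
    (hstable : ∀ K ∈ twistorSpace V, ∀ B ∈ D K, ∀ q, star q = q → Commute q J → Commute q K →
      q * B * q ∈ D K)
    (haD : ∀ i, AnnihilatedAlong (a i) D) : QCondition (polyQ J a) D := by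
  intro K hK B hB
  have hQ := isAdmissible_polyQ hJ ha
  choose p hp hpq using exists_hasFDerivAt_antiComm_pow J K
  have hdQ : ∀ B ∈ D K, dTwistor (polyQ J a) K B = ∑ i, a i K • p i B := by
    intro B hB
    have hd : HasFDerivWithinAt (polyQ J a) _ (twistorSpace V) K :=
      HasFDerivWithinAt.fun_sum fun i (_ : i ∈ Finset.univ) =>
        ((ha i).hasFDerivWithinAt hK).smul (hp i).hasFDerivWithinAt
    rw [dTwistor_eq_of_hasFDerivWithinAt hd hK (hD K hK hB), sum_apply]
    refine Finset.sum_congr rfl fun i _ => ?_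
    have hda : fderivWithin ℝ (a i) (twistorSpace V) K B = 0 := haD i K hK B hB
    simp [hda]
  rw [hdQ _ (hstable K hK B hB _ (hQ.star_eq hK) (hQ.comm_J K hK) (hQ.comm_phi K hK)), hdQ B hB,
    Finset.mul_sum, Finset.sum_mul]
  refine Finset.sum_congr rfl fun i _ => ?_
  rw [hpq i _ B (hQ.comm_J K hK) (polyQ_commute a (Commute.refl _)), mul_smul_comm, smul_mul_assoc]

theorem mul_mul_mem_unitaryAlg (hq : star q = q) (hqJ : Commute q J) (hB : B ∈ unitaryAlg J) :
    q * B * q ∈ unitaryAlg J := by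
  obtain ⟨hBs, hBJ⟩ := mem_unitaryAlg_iff.1 hB
  refine mem_unitaryAlg_iff.2 ⟨?_, ?_⟩
  · rw [star_mul, star_mul, hq, hBs, neg_mul, mul_neg, mul_assoc]
  · exact ((hqJ.symm.mul_right (Commute.symm hBJ)).mul_right hqJ.symm).symm.eq

theorem IsBasicSection.mul_mul_mem_distF (h : IsBasicSection J S L N σ κ ε) (hB : B ∈ distF S K)
    (hq : star q = q) (hqJ : Commute q J) (hqK : Commute q K) : q * B * q ∈ distF S K :=
  ⟨mul_mul_mem_skewAnti hq hqK hB.1, mul_mul_mem_kerZeroImStable (h.commute hqJ hqK).1 hB.2⟩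

theorem IsBasicSection.mul_mul_mem_distU (h : IsBasicSection J S L N σ κ ε) (hB : B ∈ distU J S K)
    (hq : star q = q) (hqJ : Commute q J) (hqK : Commute q K) : q * B * q ∈ distU J S K := by
  obtain ⟨B, ⟨hBJ, hBS⟩, rfl⟩ := hB
  exact ⟨q * B * q, ⟨mul_mul_mem_unitaryAlg hq hqJ hBJ,
    mul_mul_mem_kerZeroImStable (h.commute hqJ hqK).1 hBS⟩, commWith_mul_mul hqK.symm.eq hqK.eq⟩

variable [FiniteDimensional ℝ V]

theorem IsBasicSection.isIntegrableDistribution_distF_polyQ (h : IsBasicSection J S L N σ κ ε)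
    (hJ : J ∈ twistorSpace V) {k : ℕ} {a : Fin (k + 1) → (V →L[ℝ] V) → ℝ}
    (ha : ∀ i, SmoothOnTwistor (a i)) (haD : ∀ i, AnnihilatedAlong (a i) (distF S)) :
    IsIntegrableDistribution (twistorSpace V) (distF (fun K => polyQ J a K * S K)) :=
  h.isIntegrableDistribution_distF (isAdmissible_polyQ hJ ha) <|
    qCondition_polyQ hJ ha (fun _ _ => inf_le_left) (fun _ _ _ hB _ => h.mul_mul_mem_distF hB) haD

theorem IsBasicSection.isIntegrableDistribution_distU_polyQ (h : IsBasicSection J S L N σ κ ε)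
    (hJ : J ∈ twistorSpace V) {k : ℕ} {a : Fin (k + 1) → (V →L[ℝ] V) → ℝ}
    (ha : ∀ i, SmoothOnTwistor (a i)) (haD : ∀ i, AnnihilatedAlong (a i) (distU J S)) :
    IsIntegrableDistribution (twistorSpace V) (distU J (fun K => polyQ J a K * S K)) :=
  h.isIntegrableDistribution_distU hJ (isAdmissible_polyQ hJ ha) <|
    qCondition_polyQ hJ ha (fun _ hK => distU_le_skewAnti S hK)
      (fun _ _ _ hB _ => h.mul_mul_mem_distU hB) haD

end PolynomialSections

theorem theorem5p2 {V : Type*} [NormedAddCommGroup V] [InnerProductSpace ℝ V]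
    [FiniteDimensional ℝ V] (J : V →L[ℝ] V) (hJ : J ∈ twistorSpace V)
    (S : (V →L[ℝ] V) → (V →L[ℝ] V)) (hS : S ∈ basicSections J) :
    -- general `Q`
    (∀ Q : (V →L[ℝ] V) → (V →L[ℝ] V), IsAdmissible J Q →
      (QCondition Q (distF S) →
        IsIntegrableDistribution (twistorSpace V) (distF (fun K => Q K * S K))) ∧
      (QCondition Q (distU J S) →
        IsIntegrableDistribution (twistorSpace V) (distU J (fun K => Q K * S K)))) ∧
    -- `Q` polynomial in `{J, φ}`
    (∀ (k : ℕ) (a : Fin (k + 1) → (V →L[ℝ] V) → ℝ), (∀ i, SmoothOnTwistor (a i)) →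
      ((∀ i, AnnihilatedAlong (a i) (distF S)) →
        IsIntegrableDistribution (twistorSpace V) (distF (fun K => polyQ J a K * S K))) ∧
      ((∀ i, AnnihilatedAlong (a i) (distU J S)) →
        IsIntegrableDistribution (twistorSpace V) (distU J (fun K => polyQ J a K * S K)))) ∧
    -- `𝒟^S` and `𝒟^S_{𝔲(J)}` are integrable, and the polynomial case in terms of their leaves
    IsIntegrableDistribution (twistorSpace V) (distF S) ∧
    IsIntegrableDistribution (twistorSpace V) (distU J S) ∧
    (∀ (k : ℕ) (a : Fin (k + 1) → (V →L[ℝ] V) → ℝ), (∀ i, SmoothOnTwistor (a i)) →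
      ((∀ i, ConstantAlongLeaves (twistorSpace V) (distF S) (a i)) →
        IsIntegrableDistribution (twistorSpace V) (distF (fun K => polyQ J a K * S K))) ∧
      ((∀ i, ConstantAlongLeaves (twistorSpace V) (distU J S) (a i)) →
        IsIntegrableDistribution (twistorSpace V) (distU J (fun K => polyQ J a K * S K)))) := by
  have : CompleteSpace V := FiniteDimensional.complete ℝ V
  obtain ⟨L, N, σ, κ, ε, h⟩ := exists_isBasicSection hJ hS
  have hF : IsIntegrableDistribution (twistorSpace V) (distF S) := by
    simpa using h.isIntegrableDistribution_distF (isAdmissible_one J) (qCondition_one _)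
  have hU : IsIntegrableDistribution (twistorSpace V) (distU J S) := by
    simpa using h.isIntegrableDistribution_distU hJ (isAdmissible_one J) (qCondition_one _)
  refine ⟨fun Q hQ => ⟨?_, ?_⟩, fun k a ha => ⟨?_, ?_⟩, hF, hU, fun k a ha => ⟨?_, ?_⟩⟩
  · exact h.isIntegrableDistribution_distF hQ
  · exact h.isIntegrableDistribution_distU hJ hQ
  · exact h.isIntegrableDistribution_distF_polyQ hJ ha
  · exact h.isIntegrableDistribution_distU_polyQ hJ ha
  · exact fun hc => h.isIntegrableDistribution_distF_polyQ hJ ha fun i =>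
      (hc i).annihilatedAlong (ha i) hF
  · exact fun hc => h.isIntegrableDistribution_distU_polyQ hJ ha fun i =>
      (hc i).annihilatedAlong (ha i) hU
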